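/- For $x\in\mathbb{C}$ with $\operatorname{Re}(x)>0$ let $\theta_3(x)=1+2\sum_{n=1}^\infty e^{-\pi n^2x}$, and for $|z|<1$ let \[ \sigma(z)=\frac{1}{\sqrt{1+z}}\,\theta_3\!\left(\frac{1-z}{1+z}\right), \] where the square root is the principal branch. Put $A=\theta_3(1)$ and $\Phi=\dfrac{\Gamma(1/4)^8}{128\,\pi^4}$, and define the Romik sequence by \[ d(n)=\frac{\sigma^{(2n)}(0)}{A\,\Phi^n}\qquad(n\ge 0). \] Then all the numbers $d(n)$ are integers, and the following congruences hold. (i) $d(n)\equiv 1\pmod 2$ for all $n\ge 0$. (ii) $d(n)\equiv(-1)^{n+1}\pmod 5$ for all $n\ge 1$. (iii) If $p$ is a prime with $p\equiv 3\pmod 4$, then $d(n)\equiv 0\pmod p$ for all $n>\frac{p^2-1}{2}$. -/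

import Mathlib

/-- The Jacobi theta constant `θ₃(x) = 1 + 2 ∑_{n ≥ 1} exp(-π n² x)`, meant for `Re x > 0`. -/
noncomputable def theta3 (x : ℂ) : ℂ :=
  1 + 2 * ∑' n : ℕ, Complex.exp (-(Real.pi : ℂ) * ((n : ℂ) + 1) ^ 2 * x)

/-- `σ(z) = (1 + z)^(-1/2) θ₃((1 - z)/(1 + z))`, meant for `|z| < 1`, where `Re (1 + z) > 0`;
the square root is the principal branch. -/
noncomputable def romikSigma (z : ℂ) : ℂ :=
  1 / (1 + z) ^ (1 / 2 : ℂ) * theta3 ((1 - z) / (1 + z))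

/-- The constant `Φ = Γ(1/4)⁸ / (128 π⁴)`. -/
noncomputable def romikPhi : ℝ := Real.Gamma (1 / 4) ^ 8 / (128 * Real.pi ^ 4)

/-- The Romik sequence `d(n) = σ^(2n)(0) / (A Φⁿ)` with `A = θ₃(1)`, as complex numbers. -/
noncomputable def romikD (n : ℕ) : ℂ :=
  iteratedDeriv (2 * n) romikSigma 0 / (theta3 1 * (romikPhi : ℂ) ^ n)

/-! The function σ, a normalized modulus M = (2θ₄⁴/θ₃⁴ - 1)/√2 and a normalized logarithmic
derivative v of σ satisfy an autonomous system on the disk: σ' = κσ⁵v, M' = -2κσ⁴(1 - 2M²), v' =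
κσ⁴(1 - 2M² - 2v²), with κ = π/(2√2). Hence the k-th derivative of σ is κ^k σ^(4k+1) P_k(M, v) with
P_k an integral polynomial (`iteratedDeriv_eq_flowPoly`). At z = 0, the lemniscatic point, M = v =
0; since also Φ = κ²A⁸ (`romikPhi_eq`), d(n) = P_{2n}(0, 0) is an integer. Moreover ∂P_k/∂v is an
integer multiple of P_{k-1}, so the restrictions to v = 0 obey the two-term recursion `covIter` in
one variable.

The congruences concern this recursion alone. Modulo 2 it collapses. Modulo 5 the coefficients below
degree 5 evolve autonomously and become periodic. For p ≡ 3 mod 4, a weighted Leibniz rule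
(`covIter_leibniz`) makes the p-th iterate a first-order operator f ↦ a f + b f' modulo p, with X ∣
a by parity and X² ∣ b because an explicit truncated hypergeometric solution is annihilated. So p
steps raise the order of vanishing at 0 by one, while a single step lowers it by at most one; from
p² steps on, the value at 0 is zero.

The differential equations rest on two duplication identities for θ(q) = ∑ q^(n²), combined with the
iteration q ↦ q², which contracts to 0. The values at z = 0 come from the inversion formula, and Φ
from Gauss's arithmetic-geometric mean integral. -/

section

/-! ### The recursion `covIter`: weighted Leibniz rule and p-th iterates. -/

open Polynomial

/-- The quadratic polynomial `1 - 2 X²`. -/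
noncomputable def quadH (R : Type*) [CommRing R] : R[X] := 1 - 2 * X ^ 2

/-- The derivation `-2 (1 - 2 X²) d/dX`. -/
noncomputable def flowOp {R : Type*} [CommRing R] (f : R[X]) : R[X] :=
  -2 * quadH R * derivative f

/-- Iterated covariant derivatives of a polynomial `f` of weight `h`. -/
noncomputable def covIter {R : Type*} [CommRing R] (h : R) (f : R[X]) : ℕ → R[X]
  | 0 => f
  | 1 => flowOp f
  | (k + 2) => flowOp (covIter h f (k + 1)) +
      C ((k + 1 : R) * (2 * k + h)) * quadH R * covIter h f k

section CommRing
variable {R : Type*} [CommRing R]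

@[simp] lemma covIter_zero (h : R) (f : R[X]) : covIter h f 0 = f := rfl

@[simp] lemma covIter_one (h : R) (f : R[X]) : covIter h f 1 = flowOp f := rfl

lemma covIter_add_two (h : R) (f : R[X]) (k : ℕ) :
    covIter h f (k + 2) = flowOp (covIter h f (k + 1)) +
      C ((k + 1 : R) * (2 * k + h)) * quadH R * covIter h f k := rfl

/-- At k = 0 the truncated index `k - 1` is harmless, since its coefficient vanishes. -/
lemma covIter_succ (h : R) (f : R[X]) (k : ℕ) :
    covIter h f (k + 1) = flowOp (covIter h f k) +
      C ((k : R) * (2 * k - 2 + h)) * quadH R * covIter h f (k - 1) := by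
  cases k with
  | zero => simp
  | succ k =>
    rw [covIter_add_two]
    simp only [Nat.add_sub_cancel]
    congr 4
    push_cast
    ring

lemma flowOp_add (f g : R[X]) : flowOp (f + g) = flowOp f + flowOp g := by
  simp [flowOp, mul_add]

lemma flowOp_mul (f g : R[X]) : flowOp (f * g) = flowOp f * g + f * flowOp g := by
  simp only [flowOp, derivative_mul]; ring

lemma flowOp_C_mul (a : R) (f : R[X]) : flowOp (C a * f) = C a * flowOp f := by
  simp only [flowOp, derivative_C_mul]; ring

lemma flowOp_sum {ι : Type*} (s : Finset ι) (f : ι → R[X]) :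
    flowOp (∑ i ∈ s, f i) = ∑ i ∈ s, flowOp (f i) := by
  simp [flowOp, Finset.mul_sum]

lemma flowOp_comp_neg (f : R[X]) : (flowOp f).comp (-X) = -flowOp (f.comp (-X)) := by
  simp only [flowOp, quadH, derivative_comp, mul_comp, sub_comp, neg_comp, pow_comp, X_comp,
    one_comp, ofNat_comp, derivative_neg, derivative_X]
  ring

/-- `flowOp` reverses parity and `quadH` is even. -/
lemma covIter_comp_neg (h : R) (f : R[X]) (n : ℕ) :
    (covIter h f n).comp (-X) = C ((-1) ^ n) * covIter h (f.comp (-X)) n := by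
  induction n using Nat.twoStepInduction with
  | zero => simp
  | one => simp [flowOp_comp_neg]
  | more k h0 h1 =>
    have hH : (quadH R).comp (-X) = quadH R := by simp [quadH]
    rw [covIter_add_two, covIter_add_two, add_comp, flowOp_comp_neg, h1, mul_comp, mul_comp, hH, h0,
      flowOp_C_mul, C_comp]
    simp only [pow_succ, map_mul, map_neg, map_one]
    ring

lemma covIter_add (h : R) (f g : R[X]) (n : ℕ) :
    covIter h (f + g) n = covIter h f n + covIter h g n := by
  induction n using Nat.twoStepInduction with
  | zero => simp
  | one => simp [flowOp_add]
  | more k h0 h1 => simp only [covIter_add_two, h0, h1, flowOp_add]; ring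

lemma covIter_C_mul (h a : R) (f : R[X]) (n : ℕ) :
    covIter h (C a * f) n = C a * covIter h f n := by
  induction n using Nat.twoStepInduction with
  | zero => simp
  | one => simp [flowOp_C_mul]
  | more k h0 h1 => simp only [covIter_add_two, h0, h1, flowOp_C_mul]; ring

lemma covIter_map {S : Type*} [CommRing S] (φ : R →+* S) (h : R) (f : R[X]) (n : ℕ) :
    (covIter h f n).map φ = covIter (φ h) (f.map φ) n := by
  have hL : ∀ g : R[X], (flowOp g).map φ = flowOp (g.map φ) := by
    intro g; simp [flowOp, quadH, derivative_map]
  induction n using Nat.twoStepInduction with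
  | zero => simp
  | one => simp [hL]
  | more k h0 h1 =>
    simp only [covIter_add_two, Polynomial.map_add, Polynomial.map_mul, hL, h0, h1, map_C]
    simp [quadH, map_ofNat φ]

/-- The lower-order terms in the Leibniz rule: absorbing i and j into the binomials leaves a common
factor n + 1, and (2i + h) + (2j + h') depends only on i + j = n. This is why weights add. -/
lemma sum_antidiagonal_succ_lower (n : ℕ) (h h' : R) (F G : ℕ → R[X]) :
    ∑ ij ∈ Finset.HasAntidiagonal.antidiagonal (n + 1), ((n + 1).choose ij.1 : R[X]) *
        ((C ((ij.1 : R) * (2 * ij.1 - 2 + h)) * quadH R * F (ij.1 - 1)) * G ij.2 +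
          F ij.1 * (C ((ij.2 : R) * (2 * ij.2 - 2 + h')) * quadH R * G (ij.2 - 1))) =
      C ((n + 1 : R) * (2 * n + (h + h'))) * quadH R *
        ∑ ij ∈ Finset.HasAntidiagonal.antidiagonal n,
          (n.choose ij.1 : R[X]) * (F ij.1 * G ij.2) := by
  simp only [mul_add, Finset.sum_add_distrib]
  have e1 : ∀ i : ℕ, (((n + 1).choose (i + 1) : ℕ) : R[X]) * ((i : R[X]) + 1) =
      ((n : R[X]) + 1) * (n.choose i : R[X]) := by
    intro i
    have := Nat.add_one_mul_choose_eq n i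
    exact_mod_cast congrArg (Nat.cast : ℕ → R[X]) this.symm
  have e2 : ∀ i j : ℕ, i + j = n → (((n + 1).choose i : ℕ) : R[X]) * ((j : R[X]) + 1) =
      ((n : R[X]) + 1) * (n.choose i : R[X]) := by
    intro i j hij
    have h1 := e1 j
    rwa [Nat.choose_symm_of_eq_add (show n + 1 = (j + 1) + i by omega),
      Nat.choose_symm_of_eq_add (show n = j + i by omega)] at h1
  rw [Finset.Nat.sum_antidiagonal_succ, Finset.Nat.sum_antidiagonal_succ', Finset.mul_sum]
  simp only [Nat.cast_zero, zero_mul, C_0, mul_zero, zero_add, add_zero, Nat.add_sub_cancel]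
  rw [← Finset.sum_add_distrib]
  refine Finset.sum_congr rfl fun ij hij => ?_
  have hij' := Finset.HasAntidiagonal.mem_antidiagonal.mp hij
  have hn : (n : R[X]) = ij.1 + ij.2 := by exact_mod_cast congrArg (Nat.cast : ℕ → R[X]) hij'.symm
  have a1 := e1 ij.1
  have a2 := e2 ij.1 ij.2 hij'
  simp only [C_mul, C_add, C_sub, Nat.cast_add, Nat.cast_one, C_1, map_natCast, map_ofNat]
  linear_combination ((2 * (ij.1 : R[X]) + C h) * quadH R * F ij.1 * G ij.2) * a1 +
    ((2 * (ij.2 : R[X]) + C h') * quadH R * F ij.1 * G ij.2) * a2 -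
    2 * ((n : R[X]) + 1) * (n.choose ij.1 : R[X]) * quadH R * F ij.1 * G ij.2 * hn

theorem covIter_leibniz (h h' : R) (f g : R[X]) (n : ℕ) :
    covIter (h + h') (f * g) n = ∑ ij ∈ Finset.HasAntidiagonal.antidiagonal n,
      (n.choose ij.1 : R[X]) * (covIter h f ij.1 * covIter h' g ij.2) := by
  induction n using Nat.twoStepInduction with
  | zero => simp
  | one => simp [Finset.Nat.antidiagonal_succ, flowOp_mul]; ring
  | more n h0 h1 =>
    rw [covIter_add_two, h0, ← sum_antidiagonal_succ_lower, h1, flowOp_sum,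
      ← Finset.sum_add_distrib, Finset.sum_antidiagonal_choose_succ_mul
        (fun i j => covIter h f i * covIter h' g j) (n + 1), ← Finset.sum_add_distrib]
    refine Finset.sum_congr rfl fun ij hij => ?_
    have hc : ∀ (m : ℕ) (u : R[X]), flowOp ((m : R[X]) * u) = (m : R[X]) * flowOp u := by
      intro m u
      rw [← map_natCast (C : R →+* R[X]), flowOp_C_mul]
    have hs : (n + 1).choose ij.2 = (n + 1).choose ij.1 := by
      have := Finset.HasAntidiagonal.mem_antidiagonal.mp hij
      rw [Nat.choose_symm_of_eq_add]; omega
    rw [hc, flowOp_mul, covIter_succ h f ij.1, covIter_succ h' g ij.2, hs]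
    ring

end CommRing

section ModP
variable {p : ℕ} [hp : Fact p.Prime]

/-- The inner binomial coefficients of the Leibniz rule are divisible by p. -/
lemma covIter_prime_mul (h h' : ZMod p) (f g : (ZMod p)[X]) :
    covIter (h + h') (f * g) p = covIter h f p * g + f * covIter h' g p := by
  have hp0 := hp.out.pos
  obtain ⟨m, rfl⟩ : ∃ m, p = m + 1 := ⟨p - 1, by omega⟩
  have hcast : ∀ i, 0 < i → i < m + 1 → (((m + 1).choose i : ℕ) : (ZMod (m + 1))[X]) = 0 := by
    intro i hi0 hi
    exact (CharP.cast_eq_zero_iff _ (m + 1) _).mpr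
      (hp.out.dvd_choose_self hi0.ne' hi)
  rw [covIter_leibniz]
  have hsub : ({(0, m + 1), (m + 1, 0)} : Finset (ℕ × ℕ)) ⊆
      Finset.HasAntidiagonal.antidiagonal (m + 1) := by
    intro x hx
    simp only [Finset.mem_insert, Finset.mem_singleton] at hx
    rcases hx with rfl | rfl <;> simp
  rw [← Finset.sum_subset hsub]
  · rw [Finset.sum_pair (by simp)]
    simp
    ring
  · intro x hx hx'
    have := Finset.HasAntidiagonal.mem_antidiagonal.mp hx
    rw [hcast x.1, zero_mul]
    · by_contra h0
      apply hx'
      simp [Prod.ext_iff]; omega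
    · by_contra h0
      apply hx'
      simp [Prod.ext_iff]; omega

/-- In weight 0 the p-th iterate is a derivation, hence determined by its value on X; a general
weight follows by writing f = 1 · f with weights h + 0. -/
lemma covIter_prime_eq (h : ZMod p) (f : (ZMod p)[X]) :
    covIter h f p = covIter h 1 p * f + covIter 0 X p * derivative f := by
  let D : Derivation (ZMod p) (ZMod p)[X] (ZMod p)[X] := Derivation.mk'
    { toFun := fun f => covIter 0 f p
      map_add' := fun f g => covIter_add 0 f g p
      map_smul' := fun a f => by simp [smul_eq_C_mul, covIter_C_mul] }
    (fun a b => by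
      have := covIter_prime_mul 0 0 a b
      simp only [add_zero] at this
      simp only [LinearMap.coe_mk, AddHom.coe_mk, this, smul_eq_mul]
      ring)
  have hD : D = (covIter 0 X p : (ZMod p)[X]) •
      (derivative' : Derivation (ZMod p) (ZMod p)[X] (ZMod p)[X]) := by
    apply derivation_ext
    simp [D]
  have h1 : covIter 0 f p = covIter 0 X p * derivative f := by
    have := congrArg (fun E => E f) hD
    simpa [D] using this
  have h2 := covIter_prime_mul h 0 1 f
  rw [add_zero, one_mul, one_mul, h1] at h2
  exact h2

/-- The coefficients of the recursion depend only on the index modulo p, and the term reaching back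
across index p carries the factor p = 0, so the recursion restarts there. -/
lemma covIter_prime_shift (h : ZMod p) (f : (ZMod p)[X]) (j : ℕ) :
    covIter h f (p + j) = covIter h (covIter h f p) j := by
  induction j using Nat.twoStepInduction with
  | zero => simp
  | one => rw [covIter_succ]; simp
  | more j h0 h1 =>
    rw [← add_assoc, covIter_add_two, add_assoc, h1, h0, covIter_add_two]
    simp

lemma X_pow_dvd_flowOp {R : Type*} [CommRing R] {m : ℕ} {f : R[X]} (hf : X ^ m ∣ f) :
    X ^ (m - 1) ∣ flowOp f :=
  Dvd.dvd.mul_left (pow_sub_one_dvd_derivative_of_pow_dvd hf) _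

lemma X_pow_dvd_covIter {R : Type*} [CommRing R] {m : ℕ} (h : R) {f : R[X]} (hf : X ^ m ∣ f)
    (j : ℕ) : X ^ (m - j) ∣ covIter h f j := by
  induction j using Nat.twoStepInduction with
  | zero => simpa
  | one => exact X_pow_dvd_flowOp hf
  | more j h0 h1 =>
    rw [covIter_add_two]
    refine dvd_add ?_ (Dvd.dvd.mul_left ((pow_dvd_pow _ (by omega)).trans h0) _)
    have := X_pow_dvd_flowOp h1
    rwa [Nat.sub_sub] at this

end ModP

end

/-! ### Vanishing modulo p ≡ 3 mod 4, and the congruence modulo 2. -/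

section

open Polynomial

section ModP
variable {p : ℕ} [hp : Fact p.Prime]

/-- In weight -2 the coefficient linking index 3 back to index 1 is zero, so the iterates at 2 and 3
both vanish, and the two-term recursion then keeps all later ones zero. -/
lemma covIter_eq_zero_of_ode {R : Type*} [CommRing R] {e : R[X]}
    (he : covIter (-2) e 2 = 0) {n : ℕ} (hn : 2 ≤ n) : covIter (-2) e n = 0 := by
  induction n using Nat.strong_induction_on with
  | _ n ih =>
    obtain rfl | rfl | hn4 : n = 2 ∨ n = 3 ∨ 4 ≤ n := by omega
    · exact he
    · have h1 : (2 * ((1 : ℕ) : R) + -2) = 0 := by push_cast; ring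
      rw [covIter_add_two, he, h1]
      simp [flowOp]
    · obtain ⟨k, rfl⟩ : ∃ k, n = k + 2 := ⟨n - 2, by omega⟩
      rw [covIter_add_two, ih _ (by omega) (by omega), ih _ (by omega) (by omega)]
      simp [flowOp]

/-- Truncations of the odd series solving a hypergeometric equation in `X²`, with their defect. -/
lemma ode_truncated_series {R : Type*} [CommRing R] (α : ℕ → R) (K : ℕ)
    (hα : ∀ k < K, 2 * (2 * k + 2) * (2 * k + 3) * α (k + 1) = (4 * k + 3) ^ 2 * α k) :
    2 * quadH R * derivative (derivative (∑ k ∈ Finset.range (K + 1), C (α k) * X ^ (2 * k + 1)))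
      - 8 * X * derivative (∑ k ∈ Finset.range (K + 1), C (α k) * X ^ (2 * k + 1))
      - ∑ k ∈ Finset.range (K + 1), C (α k) * X ^ (2 * k + 1)
      = -C ((4 * K + 3) ^ 2 * α K) * X ^ (2 * K + 1) := by
  induction K with
  | zero =>
    simp only [quadH, zero_add, Finset.range_one, Finset.sum_singleton, mul_zero, pow_one,
      derivative_mul, derivative_C, derivative_X, zero_mul, map_mul, map_pow,
      Nat.cast_zero, map_ofNat]
    simp
    ring
  | succ K ih =>
    have ih' := ih (fun k hk => hα k (by omega))
    have h1 := congrArg (C : R → R[X]) (hα K (by omega))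
    rw [Finset.sum_range_succ]
    set P := ∑ k ∈ Finset.range (K + 1), C (α k) * X ^ (2 * k + 1)
    simp only [derivative_add, derivative_C_mul, derivative_X_pow]
    simp only [Nat.add_sub_cancel]
    have e1 : 2 * (K + 1) = 2 * K + 1 + 1 := by ring
    rw [e1, show 2 * K + 1 + 1 - 1 = 2 * K + 1 from rfl]
    simp only [map_mul, map_pow, map_add, map_ofNat, map_natCast, Nat.cast_add, Nat.cast_mul,
      Nat.cast_ofNat, Nat.cast_one, map_one, quadH] at *
    linear_combination ih' + X ^ (2 * K + 1) * h1

/-- With p = 4K + 3, the series stops after the term X^(2K+1): the defect carries the factor (4K +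
3)² = 0, while every denominator met before has factors smaller than p. -/
lemma exists_odd_ode_solution (h3 : p ≡ 3 [MOD 4]) :
    ∃ e : (ZMod p)[X], covIter (-2) e 2 = 0 ∧ ∃ g : (ZMod p)[X], e = X * g ∧ g.coeff 0 = 1 := by
  obtain ⟨K, hK⟩ : ∃ K, p = 4 * K + 3 := by
    refine ⟨p / 4, ?_⟩
    have := h3; unfold Nat.ModEq at this; omega
  have hunit : ∀ k < K, (2 * (2 * k + 2) * (2 * k + 3) : ZMod p) ≠ 0 := by
    intro k hk
    have hne : ∀ m : ℕ, 0 < m → m < p → (m : ZMod p) ≠ 0 := by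
      intro m h0 hm h
      exact Nat.not_dvd_of_pos_of_lt h0 hm ((ZMod.natCast_eq_zero_iff _ _).mp h)
    have a1 := hne 2 (by norm_num) (by omega)
    have a2 := hne (2 * k + 2) (by omega) (by omega)
    have a3 := hne (2 * k + 3) (by omega) (by omega)
    push_cast at a1 a2 a3
    exact mul_ne_zero (mul_ne_zero a1 a2) a3
  let α : ℕ → ZMod p := fun n => Nat.rec 1
    (fun k a => (4 * k + 3) ^ 2 * a / (2 * (2 * k + 2) * (2 * k + 3))) n
  have hα : ∀ k < K, 2 * (2 * k + 2) * (2 * k + 3) * α (k + 1) = (4 * k + 3) ^ 2 * α k :=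
    fun k hk => mul_div_cancel₀ _ (hunit k hk)
  have hp0 : (4 * K + 3 : ZMod p) = 0 := by
    have : ((4 * K + 3 : ℕ) : ZMod p) = 0 := by
      rw [← hK]; exact CharP.cast_eq_zero _ _
    exact_mod_cast this
  have hode := ode_truncated_series α K hα
  rw [hp0] at hode
  refine ⟨∑ k ∈ Finset.range (K + 1), C (α k) * X ^ (2 * k + 1), ?_,
    ∑ k ∈ Finset.range (K + 1), C (α k) * X ^ (2 * k), ?_, ?_⟩
  · rw [covIter_add_two]
    set e := ∑ k ∈ Finset.range (K + 1), C (α k) * X ^ (2 * k + 1)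
    simp [flowOp, quadH, derivative_mul] at hode ⊢
    have hC : (C 2 : (ZMod p)[X]) = 2 := map_ofNat C 2
    -- The second iterate in weight -2 is 2 `quadH` times the hypergeometric expression in `hode`.
    linear_combination 2 * (1 - 2 * X ^ 2) * hode + (2 * X ^ 2 - 1) * e * hC
  · rw [Finset.mul_sum]
    exact Finset.sum_congr rfl fun k _ => by ring
  · rw [Finset.sum_range_succ', coeff_add, finsetSum_coeff, Finset.sum_eq_zero]
    · simp [α]
    · intro k _
      simp [coeff_X_pow]

lemma X_dvd_covIter_one_prime (hp2 : p ≠ 2) (h : ZMod p) : X ∣ covIter h 1 p := by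
  have hodd := hp.out.odd_of_ne_two hp2
  have h1 := covIter_comp_neg h 1 p
  rw [hodd.neg_one_pow, one_comp] at h1
  have h2 := congrArg (eval 0) h1
  simp only [eval_comp, eval_neg, eval_X, neg_zero, eval_mul, eval_C] at h2
  rw [X_dvd_iff, coeff_zero_eq_eval_zero]
  have h20 : (2 : ZMod p) ≠ 0 := by
    intro h0
    have : ((2 : ℕ) : ZMod p) = 0 := by exact_mod_cast h0
    exact hp2 ((Nat.prime_dvd_prime_iff_eq hp.out Nat.prime_two).mp
      ((ZMod.natCast_eq_zero_iff _ _).mp this))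
  refine (mul_eq_zero.mp (?_ : 2 * eval 0 (covIter h 1 p) = 0)).resolve_left h20
  linear_combination h2

/-- Apply a f + b f' in weight -2 to the odd solution e: the result is 0, both a and e are divisible
by X, and e' has constant term 1, so b absorbs the factor X². -/
lemma X_sq_dvd_covIter_zero_X (h3 : p ≡ 3 [MOD 4]) : X ^ 2 ∣ covIter (0 : ZMod p) X p := by
  have hp2 : p ≠ 2 := by rintro rfl; exact absurd h3 (by decide)
  obtain ⟨e, he, g, rfl, hg⟩ := exists_odd_ode_solution h3
  have h0 := covIter_eq_zero_of_ode he hp.out.two_le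
  rw [covIter_prime_eq] at h0
  obtain ⟨b, hb⟩ := X_dvd_covIter_one_prime hp2 (-2 : ZMod p)
  have hco : IsCoprime (X ^ 2 : (ZMod p)[X]) (derivative (X * g)) := by
    apply IsCoprime.pow_left
    rw [irreducible_X.coprime_iff_not_dvd, X_dvd_iff]
    simp [derivative_mul, hg]
  refine hco.dvd_of_dvd_mul_right ⟨-(b * g), ?_⟩
  rw [hb] at h0
  linear_combination h0

lemma X_pow_dvd_covIter_mul_prime (h3 : p ≡ 3 [MOD 4]) (m : ℕ) :
    X ^ m ∣ covIter (1 : ZMod p) 1 (p * m) := by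
  have hp2 : p ≠ 2 := by rintro rfl; exact absurd h3 (by decide)
  have key : ∀ (m : ℕ) (r : ℕ) (f : (ZMod p)[X]), X ^ r ∣ f →
      X ^ (r + m) ∣ covIter (1 : ZMod p) f (p * m) := by
    intro m
    induction m with
    | zero => intro r f hf; simpa
    | succ m ih =>
      intro r f hf
      rw [mul_add, mul_one, add_comm (p * m), covIter_prime_shift, add_comm m, ← add_assoc]
      apply ih
      rw [covIter_prime_eq]
      refine dvd_add ?_ ?_
      · rw [pow_succ']
        exact mul_dvd_mul (X_dvd_covIter_one_prime hp2 _) hf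
      -- The derivative costs one power of X and its factor supplies two; for r = 0 the truncated
      -- subtraction only gives slack.
      · refine (pow_dvd_pow X (show r + 1 ≤ 2 + (r - 1) by omega)).trans ?_
        rw [pow_add]
        exact mul_dvd_mul (X_sq_dvd_covIter_zero_X h3) (pow_sub_one_dvd_derivative_of_pow_dvd hf)
  simpa using key m 0 1 (by simp)

/-- Write k = pm + j with j < p ≤ m: the blocks give order at least m, and the j leftover steps cost
at most j. -/
lemma eval_covIter_eq_zero (h3 : p ≡ 3 [MOD 4]) {k : ℕ} (hk : p ^ 2 ≤ k) :
    (covIter (1 : ZMod p) 1 k).eval 0 = 0 := by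
  have hshift : ∀ (m : ℕ) (f : (ZMod p)[X]) (j : ℕ),
      covIter 1 f (p * m + j) = covIter 1 (covIter 1 f (p * m)) j := by
    intro m
    induction m with
    | zero => intro f j; simp
    | succ m ih =>
      intro f j
      rw [show p * (m + 1) + j = p + (p * m + j) by ring, covIter_prime_shift, ih,
        show p * (m + 1) = p + p * m by ring, covIter_prime_shift]
  have hm : p ≤ k / p := by
    rw [Nat.le_div_iff_mul_le hp.out.pos]; nlinarith
  have hj : k % p < p := Nat.mod_lt _ hp.out.pos
  rw [← Nat.div_add_mod k p, hshift, ← coeff_zero_eq_eval_zero, ← X_dvd_iff]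
  have := X_pow_dvd_covIter (1 : ZMod p) (X_pow_dvd_covIter_mul_prime h3 (k / p)) (k % p)
  exact (dvd_pow_self X (by omega)).trans this

end ModP

/-- The integers `q_{2n}(0)`, where `q` are the covariant derivatives of `1` of weight `1`. -/
noncomputable def romikInt (n : ℕ) : ℤ := (covIter (1 : ℤ) 1 (2 * n)).eval 0

lemma romikInt_cast (R : Type*) [CommRing R] (n : ℕ) :
    (romikInt n : R) = (covIter (1 : R) 1 (2 * n)).eval 0 := by
  have := covIter_map (Int.castRingHom R) 1 1 (2 * n)
  simp only [map_one, Polynomial.map_one] at this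
  rw [← this, romikInt, eval_zero_map]
  simp

theorem romikInt_modEq_two (n : ℕ) : romikInt n ≡ 1 [ZMOD 2] := by
  refine (ZMod.intCast_eq_intCast_iff _ _ 2).mp ?_
  rw [romikInt_cast]
  suffices h : covIter (1 : ZMod 2) 1 (2 * n) = 1 by simp [h]
  have h2 : (2 : (ZMod 2)[X]) = 0 := CharTwo.two_eq_zero
  induction n with
  | zero => simp
  | succ n ih =>
    rw [mul_add, mul_one, covIter_add_two, ih]
    have h2' : (2 : ZMod 2) = 0 := rfl
    simp [flowOp, quadH, h2, h2']

theorem romikInt_modEq_prime {p : ℕ} (hp : p.Prime) (h3 : p ≡ 3 [MOD 4]) {n : ℕ}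
    (hn : p ^ 2 ≤ 2 * n) : romikInt n ≡ 0 [ZMOD p] := by
  have := Fact.mk hp
  rw [← ZMod.intCast_eq_intCast_iff, romikInt_cast, eval_covIter_eq_zero h3 hn]
  simp

end

/-! ### The congruence modulo 5 by a finite-state computation. -/

section

open Polynomial

/-- The action of the recursion on the coefficients below degree `5`, modulo `5`. -/
def stepModFive (k : ZMod 5) (s : (Fin 5 → ZMod 5) × (Fin 5 → ZMod 5)) :
    (Fin 5 → ZMod 5) × (Fin 5 → ZMod 5) :=
  (s.2, fun i =>
    (![-2 * s.2 1, -4 * s.2 2, -6 * s.2 3 + 4 * s.2 1, -8 * s.2 4 + 8 * s.2 2,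
      12 * s.2 3] : Fin 5 → ZMod 5) i +
    (k + 1) * (2 * k + 1) * (![s.1 0, s.1 1, s.1 2 - 2 * s.1 0, s.1 3 - 2 * s.1 1,
      s.1 4 - 2 * s.1 2] : Fin 5 → ZMod 5) i)

/-- The coefficients below degree `5` of two consecutive terms, modulo `5`. -/
def stateModFive : ℕ → (Fin 5 → ZMod 5) × (Fin 5 → ZMod 5)
  | 0 => (![1, 0, 0, 0, 0], 0)
  | k + 1 => stepModFive k (stateModFive k)

lemma coeff_quadH_mul {R : Type*} [CommRing R] (f : R[X]) (n : ℕ) :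
    (quadH R * f).coeff n = f.coeff n - 2 * if 2 ≤ n then f.coeff (n - 2) else 0 := by
  have : quadH R * f = f - C 2 * (X ^ 2 * f) := by
    simp only [quadH, map_ofNat]; ring
  rw [this, coeff_sub, coeff_C_mul, coeff_X_pow_mul']

lemma coeff_flowOp {R : Type*} [CommRing R] (f : R[X]) (n : ℕ) :
    (flowOp f).coeff n = -2 * (f.coeff (n + 1) * (n + 1) -
      2 * if 2 ≤ n then f.coeff (n - 2 + 1) * ((n - 2 : ℕ) + 1) else 0) := by
  have : flowOp f = C (-2) * (quadH R * derivative f) := by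
    simp only [flowOp, map_neg, map_ofNat]; ring
  rw [this, coeff_C_mul, coeff_quadH_mul]
  simp only [coeff_derivative]

/-- The truncation is closed: the only coefficient from degree 5 that could enter comes from
differentiating X⁵, and is multiplied by 5. -/
lemma stateModFive_eq (k : ℕ) : stateModFive k =
    (fun i : Fin 5 => (covIter (1 : ZMod 5) 1 k).coeff i,
      fun i : Fin 5 => (covIter (1 : ZMod 5) 1 (k + 1)).coeff i) := by
  induction k with
  | zero =>
    refine Prod.ext ?_ ?_
    · ext i; fin_cases i <;> simp [stateModFive, coeff_one]
    · ext i; fin_cases i <;> simp [stateModFive, flowOp]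
  | succ k ih =>
    have h5 : (5 : ZMod 5) = 0 := rfl
    refine Prod.ext ?_ ?_
    · simp [stateModFive, stepModFive, ih]
    · ext i
      simp only [stateModFive, stepModFive, ih, covIter_add_two, mul_assoc (C _), coeff_add,
        coeff_C_mul, coeff_flowOp, coeff_quadH_mul]
      fin_cases i <;> simp
      · ring
      · ring
      · ring
      · linear_combination 2 * (covIter (1 : ZMod 5) 1 (k + 1)).coeff 5 * h5

/-- The first values of the coefficients tracked by `stateModFive`. -/
def rowsModFive (k : ℕ) : Fin 5 → ZMod 5 :=
  List.getD [
    ![1, 0, 0, 0, 0], ![0, 0, 0, 0, 0], ![1, 0, 3, 0, 0], ![0, 3, 0, 4, 0], ![4, 0, 3, 0, 3],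
    ![0, 2, 0, 4, 0], ![1, 0, 4, 0, 3], ![0, 1, 0, 3, 0], ![4, 0, 3, 0, 1], ![0, 3, 0, 1, 0],
    ![1, 0, 1, 0, 2], ![0, 1, 0, 2, 0], ![4, 0, 1, 0, 4], ![0, 2, 0, 1, 0], ![1, 0, 2, 0, 2],
    ![0, 3, 0, 1, 0], ![4, 0, 1, 0, 2], ![0, 4, 0, 2, 0], ![1, 0, 2, 0, 4], ![0, 2, 0, 4, 0],
    ![4, 0, 4, 0, 3], ![0, 4, 0, 3, 0], ![1, 0, 4, 0, 1], ![0, 3, 0, 4, 0], ![4, 0, 3, 0, 3],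
    ![0, 2, 0, 4, 0], ![1, 0, 4, 0, 3]] k 0

lemma stateModFive_eq_rows {k : ℕ} (hk : k ≤ 25) :
    stateModFive k = (rowsModFive k, rowsModFive (k + 1)) := by
  have hstep : ∀ k : ℕ, k < 25 → stepModFive k (rowsModFive k, rowsModFive (k + 1)) =
      (rowsModFive (k + 1), rowsModFive (k + 2)) := by decide
  induction k with
  | zero => decide
  | succ k ih => rw [stateModFive, ih (by omega), hstep k (by omega)]

/-- The step depends on k only modulo 5, so one coincidence of states at indices 5 and 25
propagates. -/
lemma stateModFive_add_twenty (k : ℕ) : stateModFive (k + 5 + 20) = stateModFive (k + 5) := by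
  induction k with
  | zero =>
    rw [stateModFive_eq_rows (by norm_num), stateModFive_eq_rows (by norm_num)]
    decide
  | succ k ih =>
    rw [show k + 1 + 5 + 20 = (k + 5 + 20) + 1 by ring, show k + 1 + 5 = k + 5 + 1 by ring,
      stateModFive, ih, stateModFive]
    congr 1
    have h5 : ((25 : ℕ) : ZMod 5) = ((5 : ℕ) : ZMod 5) := rfl
    rw [Nat.cast_add, Nat.cast_add, h5]

theorem romikInt_modEq_five {n : ℕ} (hn : 1 ≤ n) : romikInt n ≡ (-1) ^ (n + 1) [ZMOD 5] := by
  refine (ZMod.intCast_eq_intCast_iff _ _ 5).mp ?_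
  rw [romikInt_cast, ← coeff_zero_eq_eval_zero]
  have h1 : (covIter (1 : ZMod 5) 1 (2 * n)).coeff 0 = (stateModFive (2 * n)).1 0 := by
    rw [stateModFive_eq]; rfl
  push_cast
  rw [h1]
  induction n using Nat.strong_induction_on with
  | _ n ih =>
    -- From n = 13 on, 2(n - 10) ≥ 5 lies in the periodic range; smaller n are covered by the table.
    -- The period 10 in n preserves the sign (-1)^(n+1).
    by_cases h : n < 13
    · clear ih h1
      rw [stateModFive_eq_rows (by omega)]
      interval_cases n <;> decide
    · obtain ⟨m, rfl⟩ : ∃ m, n = m + 10 := ⟨n - 10, by omega⟩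
      have h2 : stateModFive (2 * (m + 10)) = stateModFive (2 * m) := by
        have := stateModFive_add_twenty (2 * m - 5)
        rwa [show 2 * m - 5 + 5 + 20 = 2 * (m + 10) by omega,
          show 2 * m - 5 + 5 = 2 * m by omega] at this
      rw [h2, ih m (by omega) (by omega) (by rw [stateModFive_eq]; rfl)]
      ring

end

/-! ### From the differential system to the polynomial recursion. -/

section

open Polynomial

/-- The polynomials in `M, v` giving the iterated derivatives of `s` along solutions of the
differential system of `iteratedDeriv_eq_flowPoly`. -/
noncomputable def flowPoly : ℕ → MvPolynomial (Fin 2) ℤ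
  | 0 => 1
  | k + 1 => MvPolynomial.C (1 + 4 * (k : ℤ)) * (MvPolynomial.X 1 * flowPoly k)
      - MvPolynomial.C 2 * ((1 - MvPolynomial.C 2 * MvPolynomial.X 0 ^ 2) *
        MvPolynomial.pderiv 0 (flowPoly k))
      + (1 - MvPolynomial.C 2 * MvPolynomial.X 0 ^ 2 - MvPolynomial.C 2 * MvPolynomial.X 1 ^ 2) *
        MvPolynomial.pderiv 1 (flowPoly k)

lemma flowPoly_succ (k : ℕ) : flowPoly (k + 1) =
    MvPolynomial.C (1 + 4 * (k : ℤ)) * (MvPolynomial.X 1 * flowPoly k)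
      - MvPolynomial.C 2 * ((1 - MvPolynomial.C 2 * MvPolynomial.X 0 ^ 2) *
        MvPolynomial.pderiv 0 (flowPoly k))
      + (1 - MvPolynomial.C 2 * MvPolynomial.X 0 ^ 2 - MvPolynomial.C 2 * MvPolynomial.X 1 ^ 2) *
        MvPolynomial.pderiv 1 (flowPoly k) := rfl

/-- An Appell-type relation, proved by differentiating the recursion in v. It eliminates v: setting
v = 0 turns the ∂/∂v term into a multiple of the preceding polynomial. -/
lemma pderiv_one_flowPoly (k : ℕ) : MvPolynomial.pderiv 1 (flowPoly k) =
    MvPolynomial.C ((k : ℤ) * (2 * k - 1)) * flowPoly (k - 1) := by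
  have hcomm : ∀ f : MvPolynomial (Fin 2) ℤ, MvPolynomial.pderiv 1 (MvPolynomial.pderiv 0 f) =
      MvPolynomial.pderiv 0 (MvPolynomial.pderiv 1 f) := by
    intro f
    have : ⁅(MvPolynomial.pderiv 1 :
          Derivation ℤ (MvPolynomial (Fin 2) ℤ) (MvPolynomial (Fin 2) ℤ)),
        (MvPolynomial.pderiv 0 :
          Derivation ℤ (MvPolynomial (Fin 2) ℤ) (MvPolynomial (Fin 2) ℤ))⁆ = 0 := by
      apply MvPolynomial.derivation_ext
      intro i
      rw [Derivation.commutator_apply]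
      fin_cases i <;> simp [MvPolynomial.pderiv_X]
    have h2 := congrArg (fun D => D f) this
    simp only [Derivation.commutator_apply, Derivation.coe_zero, Pi.zero_apply] at h2
    exact sub_eq_zero.mp h2
  have hX10 : MvPolynomial.pderiv 1 (MvPolynomial.X 0 : MvPolynomial (Fin 2) ℤ) = 0 := by
    simp [MvPolynomial.pderiv_X]
  have hX11 : MvPolynomial.pderiv 1 (MvPolynomial.X 1 : MvPolynomial (Fin 2) ℤ) = 1 := by
    simp
  induction k using Nat.twoStepInduction with
  | zero => simp [flowPoly]
  | one => simp [flowPoly]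
  | more k h0 h1 =>
    have e3 := flowPoly_succ k
    rw [flowPoly_succ (k + 1)]
    simp only [Nat.add_sub_cancel, show k + 2 - 1 = k + 1 from rfl] at h1 ⊢
    simp only [map_add, map_sub, Derivation.leibniz, Derivation.leibniz_pow, hcomm, h1,
      hX10, hX11, smul_eq_mul, nsmul_eq_mul, Derivation.map_one_eq_zero, MvPolynomial.pderiv_C]
    simp only [Nat.cast_add, Nat.cast_one, Nat.cast_ofNat, map_add, map_sub, map_mul, map_one,
      map_ofNat] at *
    linear_combination -(MvPolynomial.C (k : ℤ) + 1) * (2 * (MvPolynomial.C (k : ℤ) + 1) - 1) * e3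

lemma aeval_flowPoly (k : ℕ) :
    MvPolynomial.aeval ![(X : ℤ[X]), 0] (flowPoly k) = covIter (1 : ℤ) 1 k := by
  have hder : ∀ f : MvPolynomial (Fin 2) ℤ,
      MvPolynomial.aeval ![(X : ℤ[X]), 0] (MvPolynomial.pderiv 0 f) =
        derivative (MvPolynomial.aeval ![(X : ℤ[X]), 0] f) := by
    intro f
    induction f using MvPolynomial.induction_on with
    | C a => simp
    | add f g hf hg => simp [hf, hg]
    | mul_X f i hf =>
      simp only [Derivation.leibniz, smul_eq_mul, map_add, map_mul, hf, derivative_mul,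
        MvPolynomial.aeval_X]
      fin_cases i <;> simp [MvPolynomial.pderiv_X]
      ring
  have hrec : ∀ k, MvPolynomial.aeval ![(X : ℤ[X]), 0] (flowPoly (k + 1)) =
      flowOp (MvPolynomial.aeval ![(X : ℤ[X]), 0] (flowPoly k)) +
        C ((k : ℤ) * (2 * k - 1)) * quadH ℤ *
          MvPolynomial.aeval ![(X : ℤ[X]), 0] (flowPoly (k - 1)) := by
    intro k
    rw [flowPoly_succ, pderiv_one_flowPoly]
    simp [hder, flowOp, quadH]
    ring
  induction k using Nat.twoStepInduction with
  | zero => simp [flowPoly]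
  | one => rw [hrec]; simp [flowPoly]
  | more k h0 h1 =>
    rw [hrec, h1, Nat.add_sub_cancel, h0, covIter_add_two]
    congr 4
    push_cast
    ring

lemma hasDerivAt_aeval (P : MvPolynomial (Fin 2) ℤ) {f g : ℂ → ℂ} {f' g' z : ℂ}
    (hf : HasDerivAt f f' z) (hg : HasDerivAt g g' z) :
    HasDerivAt (fun z => MvPolynomial.aeval ![f z, g z] P)
      (MvPolynomial.aeval ![f z, g z] (MvPolynomial.pderiv 0 P) * f' +
        MvPolynomial.aeval ![f z, g z] (MvPolynomial.pderiv 1 P) * g') z := by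
  induction P using MvPolynomial.induction_on with
  | C a => simpa using hasDerivAt_const z (a : ℂ)
  | add P Q hP hQ =>
    simp only [map_add]
    exact (hP.add hQ).congr_deriv (by ring)
  | mul_X P i hP =>
    have hi : HasDerivAt (fun z => (![f z, g z] : Fin 2 → ℂ) i) ((![f', g'] : Fin 2 → ℂ) i) z := by
      fin_cases i
      · exact hf
      · exact hg
    simp only [map_mul, MvPolynomial.aeval_X, Derivation.leibniz, smul_eq_mul, map_add]
    refine (hP.mul hi).congr_deriv ?_
    fin_cases i <;> simp [MvPolynomial.pderiv_X] <;> ring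

theorem iteratedDeriv_eq_flowPoly {U : Set ℂ} (hU : IsOpen U) {κ : ℂ} {s M v : ℂ → ℂ}
    (hs : ∀ z ∈ U, HasDerivAt s (κ * s z ^ 5 * v z) z)
    (hM : ∀ z ∈ U, HasDerivAt M (-2 * κ * s z ^ 4 * (1 - 2 * M z ^ 2)) z)
    (hv : ∀ z ∈ U, HasDerivAt v (κ * s z ^ 4 * (1 - 2 * M z ^ 2 - 2 * v z ^ 2)) z)
    (k : ℕ) {z : ℂ} (hz : z ∈ U) :
    iteratedDeriv k s z = κ ^ k * s z ^ (4 * k + 1) *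
      MvPolynomial.aeval ![M z, v z] (flowPoly k) := by
  induction k generalizing z with
  | zero => simp [flowPoly]
  | succ k ih =>
    rw [iteratedDeriv_succ]
    have hev : iteratedDeriv k s =ᶠ[nhds z] fun z => κ ^ k * s z ^ (4 * k + 1) *
        MvPolynomial.aeval ![M z, v z] (flowPoly k) :=
      Filter.eventually_of_mem (hU.mem_nhds hz) fun w hw => ih hw
    rw [hev.deriv_eq]
    have hd := (((hs z hz).pow (4 * k + 1)).const_mul (κ ^ k)).mul
      (hasDerivAt_aeval (flowPoly k) (hM z hz) (hv z hz))
    have hd' : HasDerivAt (fun z => κ ^ k * s z ^ (4 * k + 1) *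
        MvPolynomial.aeval ![M z, v z] (flowPoly k)) _ z := hd
    rw [hd'.deriv, flowPoly_succ]
    simp
    ring

end

/-! ### The theta series in the nome and its duplication identities. -/

section

open Filter Topology

/-- The theta series `∑ q^(n²)` over the integers, as a function of the nome `q`. -/
noncomputable def thetaQ (q : ℂ) : ℂ := ∑' n : ℤ, q ^ (n.natAbs ^ 2)

lemma summable_pow_sq_nat {r : ℝ} (h0 : 0 ≤ r) (h1 : r < 1) :
    Summable fun n : ℕ => r ^ (n ^ 2) :=
  Summable.of_nonneg_of_le (fun _ => pow_nonneg h0 _)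
    (fun n => pow_le_pow_of_le_one h0 h1.le (Nat.le_self_pow two_ne_zero n))
    (summable_geometric_of_lt_one h0 h1)

lemma summable_pow_sq_int {r : ℝ} (h0 : 0 ≤ r) (h1 : r < 1) :
    Summable fun n : ℤ => r ^ (n.natAbs ^ 2) := by
  apply Summable.of_nat_of_neg
  · simpa using summable_pow_sq_nat h0 h1
  · simpa using summable_pow_sq_nat h0 h1

lemma summable_norm_thetaQ {q : ℂ} (hq : ‖q‖ < 1) :
    Summable fun n : ℤ => ‖q ^ (n.natAbs ^ 2)‖ := by
  simpa only [norm_pow] using summable_pow_sq_int (norm_nonneg q) hq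

lemma thetaQ_eq_nat {q : ℂ} (hq : ‖q‖ < 1) :
    thetaQ q = 1 + 2 * ∑' n : ℕ, q ^ ((n + 1) ^ 2) := by
  have h := (summable_norm_thetaQ hq).of_norm
  have hn : Summable fun n : ℕ => q ^ ((n + 1) ^ 2) := by
    have : Summable fun n : ℕ => q ^ (n ^ 2) := by
      apply Summable.of_norm
      simpa only [norm_pow] using summable_pow_sq_nat (norm_nonneg q) hq
    exact (summable_nat_add_iff (f := fun n : ℕ => q ^ (n ^ 2)) 1).mpr this
  have hs : HasSum (fun n : ℤ => q ^ (n.natAbs ^ 2)) (∑' n : ℕ, q ^ ((n + 1) ^ 2) +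
      q ^ ((0 : ℤ).natAbs ^ 2) + ∑' n : ℕ, q ^ ((n + 1) ^ 2)) := by
    apply HasSum.of_add_one_of_neg_add_one
    · exact_mod_cast hn.hasSum
    · have he : ∀ n : ℕ, (-((n : ℤ) + 1)).natAbs = n + 1 := fun n => by omega
      simp only [he]
      exact hn.hasSum
  rw [thetaQ, hs.tsum_eq]
  simp
  ring

lemma thetaQ_zero : thetaQ 0 = 1 := by
  rw [thetaQ_eq_nat (by simp)]; simp

lemma differentiableOn_thetaQ : DifferentiableOn ℂ thetaQ (Metric.ball 0 1) := by
  intro q hq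
  have hq1 : ‖q‖ < 1 := by simpa using hq
  obtain ⟨r, hr1, hr2⟩ := exists_between hq1
  have hd : DifferentiableOn ℂ thetaQ (Metric.ball 0 r) := by
    apply Complex.differentiableOn_tsum_of_summable_norm
      (summable_pow_sq_int ((norm_nonneg q).trans hr1.le) hr2)
    · intro n
      fun_prop
    · exact Metric.isOpen_ball
    · intro n w hw
      rw [norm_pow]
      have : ‖w‖ < r := by simpa using hw
      exact pow_le_pow_left₀ (norm_nonneg _) this.le _
  exact (hd.differentiableAt
    (Metric.isOpen_ball.mem_nhds (by simpa using hr1))).differentiableWithinAt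

lemma differentiableAt_thetaQ {q : ℂ} (hq : ‖q‖ < 1) : DifferentiableAt ℂ thetaQ q :=
  differentiableOn_thetaQ.differentiableAt (Metric.isOpen_ball.mem_nhds (by simpa using hq))

lemma analyticAt_thetaQ {q : ℂ} (hq : ‖q‖ < 1) : AnalyticAt ℂ thetaQ q :=
  differentiableOn_thetaQ.analyticAt (Metric.isOpen_ball.mem_nhds (by simpa using hq))

/-- The map (j, k) ↦ (j + k, j - k) is a bijection of ℤ² onto the index-two sublattice of pairs with
even sum. By the parallelogram law it doubles the quadratic form, producing the nome q². -/
lemma tsum_even_lattice {f : ℤ × ℤ → ℂ} :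
    ∑' x : ℤ × ℤ, f (x.1 + x.2, x.1 - x.2) =
      ∑' x : ℤ × ℤ, if Even (x.1 + x.2) then f x else 0 := by
  have hinj : Function.Injective fun x : ℤ × ℤ => (x.1 + x.2, x.1 - x.2) := by
    rintro ⟨a, b⟩ ⟨c, d⟩ h
    simp only [Prod.mk.injEq] at h
    ext <;> simp <;> omega
  have hsupp : Function.support (fun x : ℤ × ℤ => if Even (x.1 + x.2) then f x else 0) ⊆
      Set.range fun x : ℤ × ℤ => (x.1 + x.2, x.1 - x.2) := by
    intro x hx
    have he : Even (x.1 + x.2) := by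
      by_contra h
      simp [h] at hx
    obtain ⟨j, hj⟩ := he
    exact ⟨(j, x.1 - j), by ext <;> simp; omega⟩
  rw [← hinj.tsum_eq hsupp]
  refine tsum_congr fun x => ?_
  rw [if_pos ⟨x.1, by ring⟩]

lemma natAbs_parallelogram (j k : ℤ) :
    (j + k).natAbs ^ 2 + (j - k).natAbs ^ 2 = 2 * (j.natAbs ^ 2 + k.natAbs ^ 2) := by
  zify
  simp only [sq_abs]
  ring

lemma neg_one_pow_natAbs_sq_mul {q : ℂ} (m n : ℤ) :
    (q ^ (m.natAbs ^ 2) * q ^ (n.natAbs ^ 2) + (-q) ^ (m.natAbs ^ 2) * (-q) ^ (n.natAbs ^ 2)) =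
      if Even (m + n) then 2 * (q ^ (m.natAbs ^ 2) * q ^ (n.natAbs ^ 2)) else 0 := by
  rw [neg_pow, neg_pow q (n.natAbs ^ 2)]
  split_ifs with h
  · have : Even (m.natAbs ^ 2 + n.natAbs ^ 2) := by
      rw [Nat.even_add, Nat.even_pow' two_ne_zero, Nat.even_pow' two_ne_zero, Int.natAbs_even,
        Int.natAbs_even]
      exact Int.even_add.mp h
    have h1 := this.neg_one_pow (α := ℂ)
    rw [pow_add] at h1
    linear_combination (q ^ (m.natAbs ^ 2) * q ^ (n.natAbs ^ 2)) * h1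
  · have : Odd (m.natAbs ^ 2 + n.natAbs ^ 2) := by
      rw [← Nat.not_even_iff_odd, Nat.even_add, Nat.even_pow' two_ne_zero,
        Nat.even_pow' two_ne_zero, Int.natAbs_even, Int.natAbs_even]
      exact fun h' => h (Int.even_add.mpr h')
    have h1 := this.neg_one_pow (α := ℂ)
    rw [pow_add] at h1
    linear_combination (q ^ (m.natAbs ^ 2) * q ^ (n.natAbs ^ 2)) * h1

lemma summable_mul_thetaQ {a b : ℂ} (ha : ‖a‖ < 1) (hb : ‖b‖ < 1) :
    Summable fun x : ℤ × ℤ => a ^ (x.1.natAbs ^ 2) * b ^ (x.2.natAbs ^ 2) :=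
  summable_mul_of_summable_norm (f := fun n : ℤ => a ^ (n.natAbs ^ 2))
    (g := fun n : ℤ => b ^ (n.natAbs ^ 2)) (summable_norm_thetaQ ha) (summable_norm_thetaQ hb)

lemma thetaQ_mul {a b : ℂ} (ha : ‖a‖ < 1) (hb : ‖b‖ < 1) :
    thetaQ a * thetaQ b = ∑' x : ℤ × ℤ, a ^ (x.1.natAbs ^ 2) * b ^ (x.2.natAbs ^ 2) :=
  tsum_mul_tsum_of_summable_norm (summable_norm_thetaQ ha) (summable_norm_thetaQ hb)

lemma norm_sq_lt_one {q : ℂ} (hq : ‖q‖ < 1) : ‖q ^ 2‖ < 1 := by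
  rw [norm_pow]; exact pow_lt_one₀ (norm_nonneg _) hq two_ne_zero

theorem thetaQ_sq_add {q : ℂ} (hq : ‖q‖ < 1) :
    thetaQ q ^ 2 + thetaQ (-q) ^ 2 = 2 * thetaQ (q ^ 2) ^ 2 := by
  have hq' : ‖-q‖ < 1 := by rwa [norm_neg]
  have hq2 := norm_sq_lt_one hq
  simp only [sq (thetaQ _)]
  rw [thetaQ_mul hq hq, thetaQ_mul hq' hq', thetaQ_mul hq2 hq2,
    ← (summable_mul_thetaQ hq hq).tsum_add (summable_mul_thetaQ hq' hq'), ← tsum_mul_left]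
  simp only [neg_one_pow_natAbs_sq_mul]
  rw [← tsum_even_lattice (f := fun x => 2 * (q ^ (x.1.natAbs ^ 2) * q ^ (x.2.natAbs ^ 2)))]
  refine tsum_congr fun x => ?_
  simp only [← pow_add, ← pow_mul, natAbs_parallelogram, ← mul_add]

theorem thetaQ_mul_neg {q : ℂ} (hq : ‖q‖ < 1) :
    thetaQ q * thetaQ (-q) = thetaQ (-q ^ 2) ^ 2 := by
  have hq' : ‖-q‖ < 1 := by rwa [norm_neg]
  have hq2 : ‖-q ^ 2‖ < 1 := by rw [norm_neg]; exact norm_sq_lt_one hq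
  have h : 2 * (thetaQ q * thetaQ (-q)) = 2 * (thetaQ (-q ^ 2) * thetaQ (-q ^ 2)) := by
    rw [two_mul]
    nth_rewrite 1 [mul_comm]
    rw [thetaQ_mul hq hq', thetaQ_mul hq' hq, thetaQ_mul hq2 hq2,
      ← (summable_mul_thetaQ hq' hq).tsum_add (summable_mul_thetaQ hq hq'), ← tsum_mul_left]
    have hterm : ∀ x : ℤ × ℤ, (-q) ^ (x.1.natAbs ^ 2) * q ^ (x.2.natAbs ^ 2) +
        q ^ (x.1.natAbs ^ 2) * (-q) ^ (x.2.natAbs ^ 2) = if Even (x.1 + x.2) then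
        2 * ((-q) ^ (x.1.natAbs ^ 2) * q ^ (x.2.natAbs ^ 2)) else 0 := by
      intro x
      have h1 := neg_one_pow_natAbs_sq_mul (q := q) x.1 x.2
      have h2 : ((-1 : ℂ) ^ (x.1.natAbs ^ 2)) * (-1) ^ (x.1.natAbs ^ 2) = 1 := by
        rw [← mul_pow]; simp
      rw [neg_pow q, neg_pow q (x.2.natAbs ^ 2)] at h1 ⊢
      split_ifs at h1 ⊢ with he <;>
      linear_combination ((-1 : ℂ) ^ (x.1.natAbs ^ 2)) * h1 -
        (q ^ (x.1.natAbs ^ 2) * (-1) ^ (x.2.natAbs ^ 2) * q ^ (x.2.natAbs ^ 2)) * h2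
    simp only [hterm]
    rw [← tsum_even_lattice (f := fun x => 2 * ((-q) ^ (x.1.natAbs ^ 2) * q ^ (x.2.natAbs ^ 2)))]
    refine tsum_congr fun x => ?_
    have hpar : (-1 : ℂ) ^ ((x.1 + x.2).natAbs ^ 2) =
        (-1) ^ (x.1.natAbs ^ 2) * (-1) ^ (x.2.natAbs ^ 2) := by
      rw [← pow_add]
      apply neg_one_pow_congr
      rw [Nat.even_add, Nat.even_pow' two_ne_zero, Nat.even_pow' two_ne_zero,
        Nat.even_pow' two_ne_zero, Int.natAbs_even, Int.natAbs_even, Int.natAbs_even, Int.even_add]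
    have hp := congrArg (fun n : ℕ => q ^ n) (natAbs_parallelogram x.1 x.2)
    simp only [pow_add, pow_mul] at hp
    simp only
    rw [neg_pow q, neg_pow (q ^ 2), neg_pow (q ^ 2), hpar]
    linear_combination (2 * ((-1) ^ (x.1.natAbs ^ 2) * (-1) ^ (x.2.natAbs ^ 2))) * hp
  rw [sq]
  exact mul_left_cancel₀ two_ne_zero h

lemma tendsto_iterate_sq {q : ℂ} (hq : ‖q‖ < 1) :
    Tendsto (fun n : ℕ => q ^ 2 ^ n) atTop (𝓝 0) :=
  (tendsto_pow_atTop_nhds_zero_of_norm_lt_one hq).comp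
    (tendsto_pow_atTop_atTop_of_one_lt one_lt_two)

lemma norm_iterate_sq_lt_one {q : ℂ} (hq : ‖q‖ < 1) (n : ℕ) : ‖q ^ 2 ^ n‖ < 1 := by
  rw [norm_pow]; exact pow_lt_one₀ (norm_nonneg _) hq (by positivity)

/-- By `thetaQ_mul_neg` a zero at -q propagates to every -q^(2^n), contradicting continuity and θ(0)
= 1. -/
theorem thetaQ_ne_zero {q : ℂ} (hq : ‖q‖ < 1) : thetaQ q ≠ 0 := by
  have key : ∀ q : ℂ, ‖q‖ < 1 → thetaQ (-q) ≠ 0 := by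
    intro q hq h0
    have hz : ∀ n : ℕ, thetaQ (-q ^ 2 ^ n) = 0 := by
      intro n
      induction n with
      | zero => simpa
      | succ n ih =>
        have := thetaQ_mul_neg (norm_iterate_sq_lt_one hq n)
        rw [ih, mul_zero, ← pow_mul, ← pow_succ] at this
        exact pow_eq_zero_iff two_ne_zero |>.mp this.symm
    have hlim : Tendsto (fun n : ℕ => thetaQ (-q ^ 2 ^ n)) atTop (𝓝 (thetaQ 0)) := by
      apply (differentiableAt_thetaQ (by simp)).continuousAt.tendsto.comp
      simpa using (tendsto_iterate_sq hq).neg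
    simp only [hz, thetaQ_zero] at hlim
    exact zero_ne_one (tendsto_nhds_unique tendsto_const_nhds hlim)
  simpa using key (-q) (by rwa [norm_neg])

end

/-! ### The logarithmic derivative ρ of θ and the difference ρ(q) - ρ(-q). -/

section

open Filter Topology

/-- The logarithmic derivative `q d/dq log θ(q)`. -/
noncomputable def thetaRho (q : ℂ) : ℂ := q * deriv thetaQ q / thetaQ q

lemma hasDerivAt_thetaQ {q : ℂ} (hq : ‖q‖ < 1) : HasDerivAt thetaQ (deriv thetaQ q) q :=
  (differentiableAt_thetaQ hq).hasDerivAt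

lemma hasDerivAt_thetaQ_neg {q : ℂ} (hq : ‖q‖ < 1) :
    HasDerivAt (fun q => thetaQ (-q)) (-deriv thetaQ (-q)) q :=
  ((hasDerivAt_thetaQ (q := -q) (by rwa [norm_neg])).comp q (hasDerivAt_neg q)).congr_deriv
    (by ring)

lemma eventually_norm_lt_one {q : ℂ} (hq : ‖q‖ < 1) : ∀ᶠ w in 𝓝 q, ‖w‖ < 1 :=
  continuous_norm.continuousAt.eventually_lt continuousAt_const hq

lemma deriv_thetaQ_zero : deriv thetaQ 0 = 2 := by
  have hq : (0 : ℂ) ∈ Metric.ball (0 : ℂ) (1 / 2) := by simp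
  have h := Complex.hasSum_deriv_of_summable_norm (F := fun (n : ℤ) (q : ℂ) => q ^ (n.natAbs ^ 2))
    (summable_pow_sq_int (r := 1 / 2) (by norm_num) (by norm_num))
    (fun n => by fun_prop) Metric.isOpen_ball
    (fun n w hw => by
      rw [norm_pow]
      have : ‖w‖ < 1 / 2 := by simpa using hw
      exact pow_le_pow_left₀ (norm_nonneg _) this.le _) hq
  have h2 : HasSum (fun n : ℤ => deriv (fun q : ℂ => q ^ (n.natAbs ^ 2)) 0)
      (∑ n ∈ ({1, -1} : Finset ℤ), deriv (fun q : ℂ => q ^ (n.natAbs ^ 2)) 0) := by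
    apply hasSum_sum_of_ne_finset_zero
    intro n hn
    simp only [Finset.mem_insert, Finset.mem_singleton, not_or] at hn
    rw [deriv_pow_field]
    rcases Nat.lt_or_ge n.natAbs 2 with h1 | h1
    · have : n = 0 := by omega
      simp [this]
    · have : n.natAbs ^ 2 - 1 ≠ 0 := by
        have : 2 ^ 2 ≤ n.natAbs ^ 2 := Nat.pow_le_pow_left h1 2
        omega
      simp [this]
  have h3 := h.unique h2
  rw [Finset.sum_pair (by decide)] at h3
  simp only [Int.natAbs_one, Int.natAbs_neg, one_pow, pow_one, deriv_id''] at h3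
  rw [show (2 : ℂ) = 1 + 1 by norm_num]
  exact h3

lemma thetaRho_sq {q : ℂ} (hq : ‖q‖ < 1) :
    2 * (thetaQ q ^ 2 + thetaQ (-q) ^ 2) * thetaRho (q ^ 2) =
      thetaQ q ^ 2 * thetaRho q + thetaQ (-q) ^ 2 * thetaRho (-q) := by
  have hq' : ‖-q‖ < 1 := by rwa [norm_neg]
  have hq2 := norm_sq_lt_one hq
  have h1 := ((hasDerivAt_thetaQ hq).pow 2).add ((hasDerivAt_thetaQ_neg hq).pow 2)
  have h2 := (((hasDerivAt_thetaQ hq2).comp q (hasDerivAt_pow 2 q)).pow 2).const_mul 2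
  have heq : (thetaQ ^ 2 + (fun q => thetaQ (-q)) ^ 2) =ᶠ[𝓝 q]
      fun y => 2 * ((thetaQ ∘ fun x => x ^ 2) ^ 2) y := by
    filter_upwards [eventually_norm_lt_one hq] with w hw
    exact thetaQ_sq_add hw
  have h3 := h1.unique (h2.congr_of_eventuallyEq heq)
  have e1 := thetaQ_ne_zero hq
  have e2 := thetaQ_ne_zero hq'
  have e3 := thetaQ_ne_zero hq2
  have h4 := thetaQ_sq_add hq
  rw [h4]
  simp only [thetaRho, Function.comp] at *
  field_simp
  norm_num at h3
  linear_combination -q / 2 * h3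

lemma thetaRho_neg_sq {q : ℂ} (hq : ‖q‖ < 1) :
    4 * thetaRho (-q ^ 2) = thetaRho q + thetaRho (-q) := by
  have hq' : ‖-q‖ < 1 := by rwa [norm_neg]
  have hq2 : ‖-q ^ 2‖ < 1 := by rw [norm_neg]; exact norm_sq_lt_one hq
  have h1 := (hasDerivAt_thetaQ hq).mul (hasDerivAt_thetaQ_neg hq)
  have h2 := ((hasDerivAt_thetaQ hq2).comp q (hasDerivAt_pow 2 q).neg).pow 2
  have heq : (thetaQ * fun q => thetaQ (-q)) =ᶠ[𝓝 q] (thetaQ ∘ (-fun x => x ^ 2)) ^ 2 := by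
    filter_upwards [eventually_norm_lt_one hq] with w hw
    exact thetaQ_mul_neg hw
  have h3 := h1.unique (h2.congr_of_eventuallyEq heq)
  have e1 := thetaQ_ne_zero hq
  have e2 := thetaQ_ne_zero hq'
  have e3 := thetaQ_ne_zero hq2
  have h4 := thetaQ_mul_neg hq
  simp only [Function.comp, Pi.neg_apply] at h3
  norm_num at h3
  have h5 : thetaRho (-q ^ 2) * thetaQ (-q ^ 2) ^ 2 =
      -q ^ 2 * deriv thetaQ (-q ^ 2) * thetaQ (-q ^ 2) := by
    simp only [thetaRho]; field_simp
  have h6 : (thetaRho q + thetaRho (-q)) * (thetaQ q * thetaQ (-q)) =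
      q * (deriv thetaQ q * thetaQ (-q) - thetaQ q * deriv thetaQ (-q)) := by
    simp only [thetaRho]; field_simp; ring
  rw [← h4] at h5
  apply mul_right_cancel₀ (mul_ne_zero e1 e2)
  linear_combination 4 * h5 - h6 - q * h3

lemma theta_quartic_sq {q : ℂ} (hq : ‖q‖ < 1) :
    thetaQ (q ^ 2) ^ 4 - thetaQ (-q ^ 2) ^ 4 = (thetaQ q ^ 2 - thetaQ (-q) ^ 2) ^ 2 / 4 := by
  have h1 := thetaQ_sq_add hq
  have h2 := thetaQ_mul_neg hq
  linear_combination (-(thetaQ q ^ 2 + thetaQ (-q) ^ 2) / 4 - thetaQ (q ^ 2) ^ 2 / 2) * h1 +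
    (thetaQ (-q ^ 2) ^ 2 + thetaQ q * thetaQ (-q)) * h2

lemma hasDerivAt_theta_quartic_zero :
    HasDerivAt (fun q => thetaQ q ^ 4 - thetaQ (-q) ^ 4) 16 0 := by
  have h := ((hasDerivAt_thetaQ (q := 0) (by simp)).pow 4).sub
    ((hasDerivAt_thetaQ_neg (q := 0) (by simp)).pow 4)
  refine HasDerivAt.congr_deriv h ?_
  simp [thetaQ_zero, deriv_thetaQ_zero]
  norm_num

/-- A zero would propagate along q^(2^n) → 0, but the derivative 16 at 0 makes the zero there
isolated. -/
lemma theta_quartic_ne_zero {q : ℂ} (hq : ‖q‖ < 1) (hq0 : q ≠ 0) :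
    thetaQ q ^ 4 - thetaQ (-q) ^ 4 ≠ 0 := by
  intro h0
  have hz : ∀ n : ℕ, thetaQ (q ^ 2 ^ n) ^ 4 - thetaQ (-q ^ 2 ^ n) ^ 4 = 0 := by
    intro n
    induction n with
    | zero => simpa
    | succ n ih =>
      have hn := norm_iterate_sq_lt_one hq n
      have h1 := thetaQ_sq_add hn
      have h2 := theta_quartic_sq hn
      have h3 := thetaQ_ne_zero (norm_sq_lt_one hn)
      rw [pow_succ 2, pow_mul, h2]
      have h4 : (thetaQ (q ^ 2 ^ n) ^ 2 - thetaQ (-q ^ 2 ^ n) ^ 2) *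
          (2 * thetaQ ((q ^ 2 ^ n) ^ 2) ^ 2) = 0 := by
        rw [← h1]; linear_combination ih
      rcases mul_eq_zero.mp h4 with h5 | h5
      · rw [h5]; simp
      · simp [h3] at h5
  have hne := hasDerivAt_theta_quartic_zero.eventually_ne (c := 0) (by norm_num)
  have hlim : Tendsto (fun n : ℕ => q ^ 2 ^ n) atTop (𝓝[≠] 0) :=
    tendsto_nhdsWithin_iff.mpr ⟨tendsto_iterate_sq hq,
      Eventually.of_forall fun n => pow_ne_zero _ hq0⟩
  obtain ⟨n, hn⟩ := (hlim.eventually hne).exists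
  exact hn (hz n)

lemma continuousAt_deriv_thetaQ {q : ℂ} (hq : ‖q‖ < 1) : ContinuousAt (deriv thetaQ) q :=
  (analyticAt_thetaQ hq).deriv.continuousAt

/-- The quotient of the two differences is invariant under q ↦ q², hence equals its limit at 0,
which is 4/16 by the linear terms 4q and 16q. -/
theorem thetaRho_sub {q : ℂ} (hq : ‖q‖ < 1) :
    thetaRho q - thetaRho (-q) = (thetaQ q ^ 4 - thetaQ (-q) ^ 4) / 4 := by
  rcases eq_or_ne q 0 with rfl | hq0
  · simp
  set S : ℂ → ℂ := fun q => (thetaRho q - thetaRho (-q)) / (thetaQ q ^ 4 - thetaQ (-q) ^ 4) with hS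
  have hstep : ∀ q : ℂ, ‖q‖ < 1 → q ≠ 0 → S (q ^ 2) = S q := by
    intro q hq hq0
    have h1 := theta_quartic_ne_zero hq hq0
    have h2 := theta_quartic_ne_zero (norm_sq_lt_one hq) (pow_ne_zero 2 hq0)
    have h3 := thetaRho_sq hq
    have h4 := thetaRho_neg_sq hq
    have h5 := theta_quartic_sq hq
    have h6 : thetaQ q ^ 2 + thetaQ (-q) ^ 2 ≠ 0 := by
      rw [thetaQ_sq_add hq]
      exact mul_ne_zero two_ne_zero (pow_ne_zero 2 (thetaQ_ne_zero (norm_sq_lt_one hq)))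
    simp only [hS]
    rw [div_eq_div_iff h2 h1, h5]
    linear_combination (thetaQ q ^ 2 - thetaQ (-q) ^ 2) / 2 * h3 -
      (thetaQ q ^ 4 - thetaQ (-q) ^ 4) / 4 * h4
  have hconst : ∀ n : ℕ, S (q ^ 2 ^ n) = S q := by
    intro n
    induction n with
    | zero => simp
    | succ n ih =>
      rw [pow_succ, pow_mul, hstep _ (norm_iterate_sq_lt_one hq n) (pow_ne_zero _ hq0), ih]
  have hlim : Tendsto (fun n : ℕ => q ^ 2 ^ n) atTop (𝓝[≠] 0) :=
    tendsto_nhdsWithin_iff.mpr ⟨tendsto_iterate_sq hq,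
      Eventually.of_forall fun n => pow_ne_zero _ hq0⟩
  have hS0 : Tendsto S (𝓝[≠] 0) (𝓝 (1 / 4)) := by
    have hnum : Tendsto (fun q => deriv thetaQ q / thetaQ q + deriv thetaQ (-q) / thetaQ (-q))
        (𝓝[≠] 0) (𝓝 4) := by
      have hc : ContinuousAt (fun q => deriv thetaQ q / thetaQ q) 0 :=
        (continuousAt_deriv_thetaQ (by simp)).div (differentiableAt_thetaQ (by simp)).continuousAt
          (thetaQ_ne_zero (by simp))
      have hc' : ContinuousAt (fun q => deriv thetaQ (-q) / thetaQ (-q)) 0 := by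
        refine ContinuousAt.comp (g := fun q => deriv thetaQ q / thetaQ q) (f := fun q : ℂ => -q) ?_
          continuous_neg.continuousAt
        simpa using hc
      have := (hc.add hc').tendsto.mono_left (nhdsWithin_le_nhds (s := {0}ᶜ))
      convert this using 2
      · rfl
      · simp only [Pi.add_apply, neg_zero, thetaQ_zero, deriv_thetaQ_zero]
        norm_num
    have hden := hasDerivAt_iff_tendsto_slope.mp hasDerivAt_theta_quartic_zero
    have := hnum.div hden (by norm_num)
    rw [show (4 / 16 : ℂ) = 1 / 4 by norm_num] at this
    refine this.congr' ?_
    filter_upwards [self_mem_nhdsWithin] with w hw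
    have hw0 : w ≠ 0 := hw
    simp only [slope_def_field, hS, thetaRho, Pi.div_apply, neg_zero, sub_self, sub_zero]
    rw [div_div_eq_mul_div]
    congr 1
    ring
  have h := tendsto_nhds_unique (hS0.comp hlim) (tendsto_const_nhds.congr fun n => (hconst n).symm)
  have h1 := theta_quartic_ne_zero hq hq0
  simp only [hS] at h
  rw [eq_div_iff h1] at h
  rw [← h]; ring

end

/-! ### The Riccati-type equation for ρ. -/

section

open Filter Topology

lemma hasDerivAt_thetaRho {q : ℂ} (hq : ‖q‖ < 1) :
    HasDerivAt thetaRho (deriv thetaRho q) q := by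
  have h1 := (analyticAt_thetaQ hq).deriv.differentiableAt
  have h2 := differentiableAt_thetaQ hq
  exact (((differentiableAt_id.mul h1).div h2 (thetaQ_ne_zero hq)).congr_of_eventuallyEq
    (Eventually.of_forall fun w => rfl)).hasDerivAt

lemma analyticAt_thetaRho {q : ℂ} (hq : ‖q‖ < 1) : AnalyticAt ℂ thetaRho q :=
  (analyticAt_id.mul (analyticAt_thetaQ hq).deriv).div (analyticAt_thetaQ hq) (thetaQ_ne_zero hq)

lemma two_mul_thetaRho_sq {q : ℂ} (hq : ‖q‖ < 1) :
    2 * thetaRho (q ^ 2) =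
      thetaRho q - thetaQ (-q) ^ 2 * (thetaQ q ^ 2 - thetaQ (-q) ^ 2) / 4 := by
  have h1 := thetaRho_sq hq
  have h2 := thetaRho_sub hq
  have h6 : thetaQ q ^ 2 + thetaQ (-q) ^ 2 ≠ 0 := by
    rw [thetaQ_sq_add hq]
    exact mul_ne_zero two_ne_zero (pow_ne_zero 2 (thetaQ_ne_zero (norm_sq_lt_one hq)))
  apply mul_left_cancel₀ h6
  linear_combination h1 - thetaQ (-q) ^ 2 * h2

/-- The defect V of the differential equation satisfies 4V(q²) = V(q), as one sees by
differentiating `two_mul_thetaRho_sq`. -/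
lemma thetaRho_ode_step {q : ℂ} (hq : ‖q‖ < 1) :
    4 * (q ^ 2 * deriv thetaRho (q ^ 2) - 2 * thetaRho (q ^ 2) ^ 2 -
      (thetaQ (q ^ 2) ^ 4 - thetaQ (-q ^ 2) ^ 4) * thetaQ (-q ^ 2) ^ 4 / 8) =
    q * deriv thetaRho q - 2 * thetaRho q ^ 2 -
      (thetaQ q ^ 4 - thetaQ (-q) ^ 4) * thetaQ (-q) ^ 4 / 8 := by
  have hq' : ‖-q‖ < 1 := by rwa [norm_neg]
  have hT := hasDerivAt_thetaQ hq
  have hT' := hasDerivAt_thetaQ_neg hq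
  have h1 := ((hasDerivAt_thetaRho (norm_sq_lt_one hq)).comp q (hasDerivAt_pow 2 q)).const_mul 2
  have h2 := (hasDerivAt_thetaRho hq).sub
    (((hT'.pow 2).mul ((hT.pow 2).sub (hT'.pow 2))).div_const 4)
  have h3 := h1.unique (h2.congr_of_eventuallyEq (by
    filter_upwards [eventually_norm_lt_one hq] with w hw
    exact two_mul_thetaRho_sq hw))
  simp only [Pi.pow_apply, Pi.sub_apply] at h3
  norm_num at h3
  have e1 : q * deriv thetaQ q = thetaRho q * thetaQ q := by
    have := thetaQ_ne_zero hq
    simp only [thetaRho]; field_simp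
  have e2 : q * deriv thetaQ (-q) = -thetaRho (-q) * thetaQ (-q) := by
    have := thetaQ_ne_zero hq'
    simp only [thetaRho]; field_simp
  have e3 := thetaRho_sub hq
  have e4 := theta_quartic_sq hq
  have e5 := thetaQ_mul_neg hq
  have e6 := two_mul_thetaRho_sq hq
  have e7 : thetaQ (-q ^ 2) ^ 4 = thetaQ q ^ 2 * thetaQ (-q) ^ 2 := by
    linear_combination -(thetaQ (-q ^ 2) ^ 2 + thetaQ q * thetaQ (-q)) * e5
  have e8 : thetaRho (-q) = thetaRho q - (thetaQ q ^ 4 - thetaQ (-q) ^ 4) / 4 := by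
    linear_combination -e3
  have e9 : thetaRho (q ^ 2) = (thetaRho q -
      thetaQ (-q) ^ 2 * (thetaQ q ^ 2 - thetaQ (-q) ^ 2) / 4) / 2 := by
    linear_combination e6 / 2
  rw [e4, e7, e9]
  rw [e8] at e2
  have h4 : 4 * (q ^ 2 * deriv thetaRho (q ^ 2)) = q * deriv thetaRho q -
      (2 * thetaQ (-q) * (-(q * deriv thetaQ (-q))) * (thetaQ q ^ 2 - thetaQ (-q) ^ 2) +
        thetaQ (-q) ^ 2 * (2 * thetaQ q * (q * deriv thetaQ q) +
          2 * thetaQ (-q) * (q * deriv thetaQ (-q)))) / 4 := by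
    linear_combination q * h3
  rw [e1, e2] at h4
  linear_combination h4

lemma tendsto_four_pow_mul_iterate_sq {q : ℂ} (hq : ‖q‖ < 1) :
    Tendsto (fun n : ℕ => (4 : ℂ) ^ n * q ^ 2 ^ n) atTop (𝓝 0) := by
  have h := (tendsto_pow_const_mul_const_pow_of_abs_lt_one 2
    (r := ‖q‖) (by rwa [abs_norm])).comp (tendsto_pow_atTop_atTop_of_one_lt one_lt_two)
  rw [tendsto_zero_iff_norm_tendsto_zero]
  refine h.congr fun n => ?_
  simp only [Function.comp, norm_mul, norm_pow, Nat.cast_pow, Nat.cast_ofNat]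
  -- With N = 2^n the term is N² q^N.
  rw [← pow_mul, mul_comm n 2, pow_mul]
  norm_num

/-- Iterating gives V(q) = 4^n V(q^(2^n)); since V is differentiable with V(0) = 0, this is O(4^n
q^(2^n)), which tends to 0. -/
theorem thetaRho_ode {q : ℂ} (hq : ‖q‖ < 1) :
    q * deriv thetaRho q = 2 * thetaRho q ^ 2 +
      (thetaQ q ^ 4 - thetaQ (-q) ^ 4) * thetaQ (-q) ^ 4 / 8 := by
  set V : ℂ → ℂ := fun q => q * deriv thetaRho q - 2 * thetaRho q ^ 2 -
      (thetaQ q ^ 4 - thetaQ (-q) ^ 4) * thetaQ (-q) ^ 4 / 8 with hV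
  have hiter : ∀ n : ℕ, 4 ^ n * V (q ^ 2 ^ n) = V q := by
    intro n
    induction n with
    | zero => simp
    | succ n ih =>
      have h := thetaRho_ode_step (norm_iterate_sq_lt_one hq n)
      rw [← ih, pow_succ 2, pow_mul, pow_succ, mul_assoc]
      exact congrArg _ h
  have h0 : ‖(0 : ℂ)‖ < 1 := by simp
  have hVd : DifferentiableAt ℂ V 0 := by
    have h1 := (analyticAt_thetaRho h0).deriv.differentiableAt
    have h2 := (analyticAt_thetaRho h0).differentiableAt
    have h3 := differentiableAt_thetaQ h0
    have h4 := (hasDerivAt_thetaQ_neg h0).differentiableAt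
    exact ((differentiableAt_id.mul h1).sub ((h2.pow 2).const_mul 2)).sub
      ((((h3.pow 4).sub (h4.pow 4)).mul (h4.pow 4)).div_const 8)
  have hV0 : V 0 = 0 := by simp [hV, thetaRho]
  have hO := hVd.hasDerivAt.isBigO_sub.comp_tendsto (tendsto_iterate_sq hq)
  have hO2 : (fun n : ℕ => 4 ^ n * V (q ^ 2 ^ n)) =O[atTop] fun n => (4 : ℂ) ^ n * q ^ 2 ^ n := by
    refine (Asymptotics.isBigO_refl (fun n : ℕ => (4 : ℂ) ^ n) atTop).mul ?_
    simpa [hV0, Function.comp_def] using hO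
  have hlim := hO2.trans_tendsto (tendsto_four_pow_mul_iterate_sq hq)
  have h := tendsto_nhds_unique hlim (tendsto_const_nhds.congr fun n => (hiter n).symm)
  simp only [hV] at h
  linear_combination -h

end

/-! ### The differential system in the disk coordinate. -/

section

open Filter Topology

lemma norm_exp_neg_pi_lt_one {x : ℂ} (hx : 0 < x.re) : ‖Complex.exp (-(Real.pi : ℂ) * x)‖ < 1 := by
  rw [Complex.norm_exp, Real.exp_lt_one_iff]
  simp only [Complex.mul_re, Complex.neg_re, Complex.ofReal_re, Complex.neg_im, Complex.ofReal_im,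
    neg_zero, zero_mul, sub_zero]
  nlinarith [Real.pi_pos]

lemma theta3_eq_thetaQ {x : ℂ} (hx : 0 < x.re) :
    theta3 x = thetaQ (Complex.exp (-(Real.pi : ℂ) * x)) := by
  rw [thetaQ_eq_nat (norm_exp_neg_pi_lt_one hx), theta3]
  congr 3
  ext n
  rw [← Complex.exp_nat_mul]
  congr 1
  push_cast
  ring

lemma one_add_re_pos {z : ℂ} (hz : ‖z‖ < 1) : 0 < (1 + z).re := by
  have := (abs_le.mp (Complex.abs_re_le_norm z)).1
  simp; linarith

lemma one_add_ne_zero {z : ℂ} (hz : ‖z‖ < 1) : 1 + z ≠ 0 := by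
  intro h
  have := one_add_re_pos hz
  simp [h] at this

lemma cayley_re_pos {z : ℂ} (hz : ‖z‖ < 1) : 0 < ((1 - z) / (1 + z)).re := by
  have h1 : 0 < Complex.normSq (1 + z) := Complex.normSq_pos.mpr (one_add_ne_zero hz)
  have h2 : Complex.normSq z < 1 := by
    rw [Complex.normSq_eq_norm_sq]
    exact pow_lt_one₀ (norm_nonneg z) hz two_ne_zero
  rw [Complex.normSq_apply] at h2
  rw [Complex.div_re, ← add_div]
  apply div_pos _ h1
  simp
  nlinarith

/-- The nome as a function of the disk coordinate. -/
noncomputable def diskNome (z : ℂ) : ℂ :=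
  Complex.exp (-(Real.pi : ℂ) * ((1 - z) / (1 + z)))

lemma norm_diskNome_lt_one {z : ℂ} (hz : ‖z‖ < 1) : ‖diskNome z‖ < 1 :=
  norm_exp_neg_pi_lt_one (cayley_re_pos hz)

lemma romikSigma_eq {z : ℂ} (hz : ‖z‖ < 1) :
    romikSigma z = thetaQ (diskNome z) / (1 + z) ^ (1 / 2 : ℂ) := by
  rw [romikSigma, theta3_eq_thetaQ (cayley_re_pos hz), diskNome]
  ring

lemma hasDerivAt_diskNome {z : ℂ} (hz : ‖z‖ < 1) :
    HasDerivAt diskNome (2 * Real.pi / (1 + z) ^ 2 * diskNome z) z := by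
  have h0 := one_add_ne_zero hz
  have h1 : HasDerivAt (fun z : ℂ => -(Real.pi : ℂ) * ((1 - z) / (1 + z)))
      (-(Real.pi : ℂ) * ((-1 * (1 + z) - (1 - z) * 1) / (1 + z) ^ 2)) z :=
    (((hasDerivAt_id z).const_sub 1).div ((hasDerivAt_id z).const_add 1) h0).const_mul _
  refine h1.cexp.congr_deriv ?_
  simp only [diskNome]
  field_simp
  ring

lemma hasDerivAt_thetaQ_diskNome {z : ℂ} (hz : ‖z‖ < 1) :
    HasDerivAt (fun z => thetaQ (diskNome z))
      (2 * Real.pi / (1 + z) ^ 2 * thetaRho (diskNome z) * thetaQ (diskNome z)) z := by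
  have hq := norm_diskNome_lt_one hz
  refine ((hasDerivAt_thetaQ hq).comp z (hasDerivAt_diskNome hz)).congr_deriv ?_
  have := thetaQ_ne_zero hq
  have h0 := one_add_ne_zero hz
  simp only [thetaRho]
  field_simp

lemma hasDerivAt_thetaQ_neg_diskNome {z : ℂ} (hz : ‖z‖ < 1) :
    HasDerivAt (fun z => thetaQ (-diskNome z))
      (2 * Real.pi / (1 + z) ^ 2 * thetaRho (-diskNome z) * thetaQ (-diskNome z)) z := by
  have hq := norm_diskNome_lt_one hz
  have hq' : ‖-diskNome z‖ < 1 := by rwa [norm_neg]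
  refine ((hasDerivAt_thetaQ_neg hq).comp z (hasDerivAt_diskNome hz)).congr_deriv ?_
  have := thetaQ_ne_zero hq'
  have h0 := one_add_ne_zero hz
  simp only [thetaRho]
  field_simp

lemma hasDerivAt_thetaRho_diskNome {z : ℂ} (hz : ‖z‖ < 1) :
    HasDerivAt (fun z => thetaRho (diskNome z))
      (2 * Real.pi / (1 + z) ^ 2 * (2 * thetaRho (diskNome z) ^ 2 +
      (thetaQ (diskNome z) ^ 4 - thetaQ (-diskNome z) ^ 4) * thetaQ (-diskNome z) ^ 4 / 8)) z := by
  have hq := norm_diskNome_lt_one hz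
  refine ((hasDerivAt_thetaRho hq).comp z (hasDerivAt_diskNome hz)).congr_deriv ?_
  rw [← thetaRho_ode hq]
  ring

/-- The constant `π / (2√2)`. -/
noncomputable def diskKappa : ℂ := (Real.pi : ℂ) / (2 * (Real.sqrt 2 : ℂ))

/-- The normalized modulus `(2 θ₄⁴/θ₃⁴ - 1)/√2` in the disk coordinate. -/
noncomputable def diskM (z : ℂ) : ℂ :=
  (2 * (thetaQ (-diskNome z) ^ 4 / thetaQ (diskNome z) ^ 4) - 1) / (Real.sqrt 2 : ℂ)

/-- The normalized logarithmic derivative of `σ` in the disk coordinate. -/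
noncomputable def diskV (z : ℂ) : ℂ :=
  (2 * Real.pi * thetaRho (diskNome z) - (1 + z) / 2) / (diskKappa * thetaQ (diskNome z) ^ 4)

lemma sqrt_two_sq : (Real.sqrt 2 : ℂ) ^ 2 = 2 := by
  rw [← Complex.ofReal_pow, Real.sq_sqrt (by norm_num)]; norm_num

lemma sqrt_two_ne_zero : (Real.sqrt 2 : ℂ) ≠ 0 := by
  intro h
  have := sqrt_two_sq
  simp [h] at this

lemma complex_pi_ne_zero : (Real.pi : ℂ) ≠ 0 := Complex.ofReal_ne_zero.mpr Real.pi_ne_zero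

lemma diskKappa_ne_zero : diskKappa ≠ 0 :=
  div_ne_zero complex_pi_ne_zero (mul_ne_zero two_ne_zero sqrt_two_ne_zero)

lemma diskKappa_sq : diskKappa ^ 2 = (Real.pi : ℂ) ^ 2 / 8 := by
  rw [diskKappa, div_pow, mul_pow, sqrt_two_sq]; norm_num

lemma one_add_cpow_half_sq (z : ℂ) : ((1 + z) ^ (1 / 2 : ℂ)) ^ 2 = 1 + z := by
  simp

lemma romikSigma_pow_four {z : ℂ} (hz : ‖z‖ < 1) :
    romikSigma z ^ 4 = thetaQ (diskNome z) ^ 4 / (1 + z) ^ 2 := by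
  rw [romikSigma_eq hz, div_pow]
  congr 1
  nth_rewrite 2 [← one_add_cpow_half_sq z]
  ring

lemma hasDerivAt_romikSigma {z : ℂ} (hz : ‖z‖ < 1) :
    HasDerivAt romikSigma (diskKappa * romikSigma z ^ 5 * diskV z) z := by
  have h0 := one_add_ne_zero hz
  have hq := thetaQ_ne_zero (norm_diskNome_lt_one hz)
  have hg2 := one_add_cpow_half_sq z
  have hg : HasDerivAt (fun z : ℂ => (1 + z) ^ (1 / 2 : ℂ))
      ((1 + z) ^ (1 / 2 : ℂ) / (2 * (1 + z))) z := by
    refine (((hasDerivAt_id z).const_add 1).cpow_const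
      (c := 1 / 2) (Or.inl (one_add_re_pos hz))).congr_deriv ?_
    simp only [id]
    rw [Complex.cpow_sub _ _ h0, Complex.cpow_one]
    field_simp
  have hg0 : (1 + z) ^ (1 / 2 : ℂ) ≠ 0 := by
    intro h
    rw [h] at hg2
    apply h0
    rw [← hg2]; norm_num
  have hd := (hasDerivAt_thetaQ_diskNome hz).div hg hg0
  have hev : romikSigma =ᶠ[𝓝 z] fun z => thetaQ (diskNome z) / (1 + z) ^ (1 / 2 : ℂ) := by
    filter_upwards [eventually_norm_lt_one hz] with w hw
    exact romikSigma_eq hw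
  refine (hd.congr_of_eventuallyEq hev).congr_deriv ?_
  have hk := diskKappa_ne_zero
  have e1 : diskKappa * romikSigma z ^ 5 * diskV z =
      romikSigma z * (2 * Real.pi * thetaRho (diskNome z) / (1 + z) ^ 2 - 1 / (2 * (1 + z))) := by
    rw [show romikSigma z ^ 5 = romikSigma z * romikSigma z ^ 4 by ring, romikSigma_pow_four hz,
      diskV]
    field_simp
  rw [e1, romikSigma_eq hz]
  field_simp

lemma hasDerivAt_diskM {z : ℂ} (hz : ‖z‖ < 1) :
    HasDerivAt diskM (-2 * diskKappa * romikSigma z ^ 4 * (1 - 2 * diskM z ^ 2)) z := by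
  have h0 := one_add_ne_zero hz
  have hq := thetaQ_ne_zero (norm_diskNome_lt_one hz)
  have hd := (((((hasDerivAt_thetaQ_neg_diskNome hz).pow 4).div
    ((hasDerivAt_thetaQ_diskNome hz).pow 4) (pow_ne_zero 4 hq)).const_mul 2).sub_const 1).div_const
    (Real.sqrt 2 : ℂ)
  refine HasDerivAt.congr_deriv hd ?_
  have hr := sqrt_two_ne_zero
  have hsub := thetaRho_sub (norm_diskNome_lt_one hz)
  have hM : 2 * diskM z ^ 2 =
      (2 * (thetaQ (-diskNome z) ^ 4 / thetaQ (diskNome z) ^ 4) - 1) ^ 2 := by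
    rw [diskM, div_pow, sqrt_two_sq]; ring
  rw [hM, romikSigma_pow_four hz, diskKappa]
  have e8 : thetaRho (-diskNome z) = thetaRho (diskNome z) -
      (thetaQ (diskNome z) ^ 4 - thetaQ (-diskNome z) ^ 4) / 4 := by
    linear_combination -hsub
  simp only [Pi.pow_apply]
  rw [e8]
  push_cast
  field_simp
  ring

lemma hasDerivAt_diskV {z : ℂ} (hz : ‖z‖ < 1) :
    HasDerivAt diskV
      (diskKappa * romikSigma z ^ 4 * (1 - 2 * diskM z ^ 2 - 2 * diskV z ^ 2)) z := by
  have h0 := one_add_ne_zero hz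
  have hq := thetaQ_ne_zero (norm_diskNome_lt_one hz)
  have hk := diskKappa_ne_zero
  have hd := (((hasDerivAt_thetaRho_diskNome hz).const_mul (2 * Real.pi : ℂ)).sub
    (((hasDerivAt_id z).const_add 1).div_const 2)).div
    (((hasDerivAt_thetaQ_diskNome hz).pow 4).const_mul diskKappa)
    (mul_ne_zero hk (pow_ne_zero 4 hq))
  refine HasDerivAt.congr_deriv hd ?_
  have hM : 2 * diskM z ^ 2 =
      (2 * (thetaQ (-diskNome z) ^ 4 / thetaQ (diskNome z) ^ 4) - 1) ^ 2 := by
    rw [diskM, div_pow, sqrt_two_sq]; ring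
  rw [hM, romikSigma_pow_four hz, diskV]
  -- This value of κ² is what turns the quartic term of the equation for ρ into 1 - 2M².
  have hp : (Real.pi : ℂ) ^ 2 = 8 * diskKappa ^ 2 := by rw [diskKappa_sq]; ring
  simp only [Pi.pow_apply, Pi.sub_apply, id]
  push_cast
  generalize thetaQ (-diskNome z) = b at *
  generalize thetaQ (diskNome z) = a at *
  generalize thetaRho (diskNome z) = r at *
  generalize (Real.pi : ℂ) = c at *
  generalize diskKappa = k at *
  field_simp
  linear_combination (8 * b ^ 4 * a ^ 4 - 8 * b ^ 8) * hp

end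

/-! ### Values at the centre of the disk. -/

section

open Filter Topology

lemma thetaQ_exp_inv {x : ℂ} (hx : 0 < x.re) :
    thetaQ (Complex.exp (-(Real.pi : ℂ) * x)) =
      1 / x ^ (1 / 2 : ℂ) * thetaQ (Complex.exp (-(Real.pi : ℂ) * (1 / x))) := by
  have h := Complex.tsum_exp_neg_mul_int_sq hx
  have hterm : ∀ y : ℂ, thetaQ (Complex.exp (-(Real.pi : ℂ) * y)) =
      ∑' n : ℤ, Complex.exp (-(Real.pi : ℂ) * y * (n : ℂ) ^ 2) := by
    intro y
    refine tsum_congr fun n => ?_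
    rw [← Complex.exp_nat_mul]
    congr 1
    have : ((n.natAbs ^ 2 : ℕ) : ℂ) = (n : ℂ) ^ 2 := by
      have h2 : ((n.natAbs ^ 2 : ℕ) : ℤ) = n ^ 2 := by push_cast; exact sq_abs n
      rw [← Int.cast_natCast, h2, Int.cast_pow]
    rw [this]; ring
  rw [hterm, hterm, h]
  congr 2
  ext n
  congr 1
  ring

lemma diskNome_zero : diskNome 0 = Complex.exp (-(Real.pi : ℂ)) := by simp [diskNome]

lemma norm_exp_neg_pi : ‖Complex.exp (-(Real.pi : ℂ))‖ < 1 := by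
  simpa using norm_exp_neg_pi_lt_one (x := 1) (by simp)

/-- Differentiate the inversion formula at its fixed point x = 1. -/
lemma thetaRho_exp_neg_pi : thetaRho (Complex.exp (-(Real.pi : ℂ))) = 1 / (4 * Real.pi) := by
  set F : ℂ → ℂ := fun x => thetaQ (Complex.exp (-(Real.pi : ℂ) * x)) with hF
  have hq := norm_exp_neg_pi
  have hd : HasDerivAt F (-(Real.pi : ℂ) * thetaRho (Complex.exp (-(Real.pi : ℂ))) *
      thetaQ (Complex.exp (-(Real.pi : ℂ)))) 1 := by
    have h1 : HasDerivAt (fun x : ℂ => Complex.exp (-(Real.pi : ℂ) * x))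
        (Complex.exp (-(Real.pi : ℂ) * 1) * (-(Real.pi : ℂ) * 1)) 1 :=
      ((hasDerivAt_id (1 : ℂ)).const_mul (-(Real.pi : ℂ))).cexp
    have h2 : HasDerivAt thetaQ (deriv thetaQ (Complex.exp (-(Real.pi : ℂ))))
        (Complex.exp (-(Real.pi : ℂ) * 1)) := by
      rw [mul_one]; exact hasDerivAt_thetaQ hq
    refine (h2.comp 1 h1).congr_deriv ?_
    have := thetaQ_ne_zero hq
    simp only [thetaRho, mul_one]
    field_simp
  have hd' : HasDerivAt F (-(Real.pi : ℂ) * thetaRho (Complex.exp (-(Real.pi : ℂ))) *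
      thetaQ (Complex.exp (-(Real.pi : ℂ)))) (1 / 1) := by rwa [div_one]
  have hinv : HasDerivAt (fun x : ℂ => 1 / x) (-1) 1 := by
    simpa using hasDerivAt_inv (one_ne_zero (α := ℂ))
  have hpow : HasDerivAt (fun x : ℂ => x ^ (1 / 2 : ℂ)) (1 / 2) 1 := by
    refine ((hasDerivAt_id (1 : ℂ)).cpow_const (c := 1 / 2) (by simp)).congr_deriv ?_
    simp
  have hrhs := (hpow.fun_inv (by simp)).mul (hd'.comp 1 hinv)
  have hev : F =ᶠ[𝓝 1] (fun x : ℂ => (x ^ (1 / 2 : ℂ))⁻¹) * (F ∘ fun x => 1 / x) := by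
    have hre : ∀ᶠ x : ℂ in 𝓝 1, 0 < x.re :=
      continuousAt_const.eventually_lt Complex.continuous_re.continuousAt (by simp)
    filter_upwards [hre] with x hx
    simpa [hF] using thetaQ_exp_inv hx
  have h := hd.unique (hrhs.congr_of_eventuallyEq hev)
  have hF1 : F 1 = thetaQ (Complex.exp (-(Real.pi : ℂ))) := by simp [hF]
  have hne := thetaQ_ne_zero hq
  have hpi := complex_pi_ne_zero
  simp only [Function.comp, Complex.one_cpow, div_one, hF1] at h
  rw [eq_div_iff (mul_ne_zero (by norm_num) hpi)]
  apply mul_right_cancel₀ hne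
  linear_combination -2 * h

/-- Duplication expresses nomes e^(-π/2) and e^(-2π) through a = θ(e^(-π)), b = θ(-e^(-π));
inversion relates these two nomes, giving (a² + b²)(a² - b²) = b⁴. -/
lemma thetaQ_exp_neg_pi_pow_four : thetaQ (Complex.exp (-(Real.pi : ℂ))) ^ 4 =
    2 * thetaQ (-Complex.exp (-(Real.pi : ℂ))) ^ 4 := by
  have hq := norm_exp_neg_pi
  set q₀ : ℂ := Complex.exp (-(Real.pi : ℂ) * (1 / 2)) with hq₀
  have hq₀n : ‖q₀‖ < 1 := norm_exp_neg_pi_lt_one (by norm_num)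
  have e1 : q₀ ^ 2 = Complex.exp (-(Real.pi : ℂ)) := by
    rw [hq₀, ← Complex.exp_nat_mul]; congr 1; push_cast; ring
  have e2 : Complex.exp (-(Real.pi : ℂ)) ^ 2 = Complex.exp (-(Real.pi : ℂ) * 2) := by
    rw [← Complex.exp_nat_mul]; congr 1; push_cast; ring
  have h1 := thetaQ_sq_add hq₀n
  have h2 := thetaQ_mul_neg hq₀n
  have h3 := thetaQ_sq_add hq
  have h4 := thetaQ_exp_inv (x := 2) (by norm_num)
  rw [e1] at h1 h2
  rw [e2] at h3
  have h5 : 2 * thetaQ (Complex.exp (-(Real.pi : ℂ) * 2)) ^ 2 = thetaQ q₀ ^ 2 := by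
    rw [h4, mul_pow, div_pow]
    have : ((2 : ℂ) ^ (1 / 2 : ℂ)) ^ 2 = 2 := by simp
    rw [this, hq₀]; ring
  rw [h5] at h3
  have h6 : thetaQ (-q₀) ^ 2 = thetaQ (Complex.exp (-(Real.pi : ℂ))) ^ 2 -
      thetaQ (-Complex.exp (-(Real.pi : ℂ))) ^ 2 := by linear_combination h1 + h3
  have h7 : thetaQ q₀ ^ 2 * thetaQ (-q₀) ^ 2 = thetaQ (-Complex.exp (-(Real.pi : ℂ))) ^ 4 := by
    rw [← mul_pow, h2]; ring
  rw [← h3, h6] at h7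
  linear_combination h7

lemma diskV_zero : diskV 0 = 0 := by
  rw [diskV, diskNome_zero, thetaRho_exp_neg_pi]
  have := complex_pi_ne_zero
  field_simp
  norm_num

lemma diskM_zero : diskM 0 = 0 := by
  rw [diskM, diskNome_zero, thetaQ_exp_neg_pi_pow_four]
  have : thetaQ (-Complex.exp (-(Real.pi : ℂ))) ≠ 0 :=
    thetaQ_ne_zero (by rw [norm_neg]; exact norm_exp_neg_pi)
  field_simp
  norm_num

lemma theta3_one : theta3 1 = thetaQ (Complex.exp (-(Real.pi : ℂ))) := by
  rw [theta3_eq_thetaQ (by simp), mul_one]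

lemma romikSigma_zero : romikSigma 0 = theta3 1 := by
  simp [romikSigma]

theorem iteratedDeriv_romikSigma_zero (n : ℕ) : iteratedDeriv (2 * n) romikSigma 0 =
    diskKappa ^ (2 * n) * theta3 1 ^ (4 * (2 * n) + 1) * romikInt n := by
  have hmem : ∀ z ∈ Metric.ball (0 : ℂ) 1, ‖z‖ < 1 := fun z hz => by simpa using hz
  rw [iteratedDeriv_eq_flowPoly Metric.isOpen_ball
    (fun z hz => hasDerivAt_romikSigma (hmem z hz)) (fun z hz => hasDerivAt_diskM (hmem z hz))
    (fun z hz => hasDerivAt_diskV (hmem z hz)) (2 * n) (by simp), diskM_zero, diskV_zero,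
    romikSigma_zero]
  congr 1
  have hcomp : (MvPolynomial.aeval ![(0 : ℂ), 0] : MvPolynomial (Fin 2) ℤ →ₐ[ℤ] ℂ) =
      (Polynomial.aeval (0 : ℂ)).comp (MvPolynomial.aeval ![(Polynomial.X : Polynomial ℤ), 0]) := by
    apply MvPolynomial.algHom_ext
    intro i
    fin_cases i <;> simp
  rw [hcomp, AlgHom.comp_apply, aeval_flowPoly, romikInt, Polynomial.aeval_def,
    Polynomial.eval₂_at_zero, Polynomial.coeff_zero_eq_eval_zero]
  simp

end

/-! ### The arithmetic-geometric mean integral at theta values. -/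

section

open Filter Topology MeasureTheory Set

/-- The complete elliptic integral `∫₀^∞ dt / √((t² + a²)(t² + b²))`. -/
noncomputable def agmIntegral (a b : ℝ) : ℝ :=
  ∫ t in Ioi (0 : ℝ), 1 / √((t ^ 2 + a ^ 2) * (t ^ 2 + b ^ 2))

/-- Gauss's invariance, through the substitution u = (t - ab/t)/2. -/
theorem agmIntegral_step {a b c : ℝ} (ha : 0 < a) (hb : 0 < b) (hc : c ^ 2 = a * b) :
    agmIntegral ((a + b) / 2) c = agmIntegral a b := by
  set f : ℝ → ℝ := fun t => (t - a * b / t) / 2 with hf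
  have hab : 0 < a * b := mul_pos ha hb
  have hderiv : ∀ t ∈ Ioi (0 : ℝ),
      HasDerivWithinAt f ((t ^ 2 + a * b) / (2 * t ^ 2)) (Ioi 0) t := by
    intro t ht
    have ht0 : t ≠ 0 := ne_of_gt ht
    have h1 : HasDerivAt f ((1 - (0 * t - a * b * 1) / t ^ 2) / 2) t :=
      ((hasDerivAt_id t).sub ((hasDerivAt_const t (a * b)).div (hasDerivAt_id t) ht0)).div_const 2
    refine (h1.congr_deriv ?_).hasDerivWithinAt
    field_simp
    ring
  have hinj : InjOn f (Ioi 0) := by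
    intro s hs t ht hst
    have hs0 : 0 < s := hs
    have ht0 : 0 < t := ht
    simp only [hf] at hst
    field_simp at hst
    have : (s - t) * (s * t + a * b) = 0 := by linear_combination hst
    rcases mul_eq_zero.mp this with h | h
    · linarith
    · nlinarith [mul_pos hs0 ht0]
  have himage : f '' Ioi 0 = univ := by
    refine eq_univ_of_forall fun y => ?_
    have hr : 0 < y + √(y ^ 2 + a * b) := by
      have : |y| < √(y ^ 2 + a * b) := by
        rw [← Real.sqrt_sq_eq_abs]
        exact Real.sqrt_lt_sqrt (sq_nonneg y) (by linarith)
      linarith [neg_abs_le y]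
    refine ⟨y + √(y ^ 2 + a * b), hr, ?_⟩
    have hsq : √(y ^ 2 + a * b) ^ 2 = y ^ 2 + a * b := Real.sq_sqrt (by positivity)
    simp only [hf]
    field_simp
    linear_combination hsq
  have hmain := integral_image_eq_integral_abs_deriv_smul measurableSet_Ioi hderiv hinj
    (fun u => 1 / √((u ^ 2 + ((a + b) / 2) ^ 2) * (u ^ 2 + c ^ 2)))
  rw [himage, Measure.restrict_univ] at hmain
  -- The substitution covers the whole line; evenness of the integrand folds it back to the
  -- half-line with a factor 2.
  have habs := integral_comp_abs
    (f := fun u => 1 / √((u ^ 2 + ((a + b) / 2) ^ 2) * (u ^ 2 + c ^ 2)))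
  simp only [sq_abs] at habs
  rw [habs] at hmain
  have hrhs : ∫ t in Ioi (0 : ℝ), |(t ^ 2 + a * b) / (2 * t ^ 2)| •
      (1 / √((f t ^ 2 + ((a + b) / 2) ^ 2) * (f t ^ 2 + c ^ 2))) =
      2 * ∫ t in Ioi (0 : ℝ), 1 / √((t ^ 2 + a ^ 2) * (t ^ 2 + b ^ 2)) := by
    rw [← integral_const_mul]
    refine setIntegral_congr_fun measurableSet_Ioi fun t ht => ?_
    have ht0 : 0 < t := ht
    have hP : (f t ^ 2 + ((a + b) / 2) ^ 2) * (f t ^ 2 + c ^ 2) =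
        ((t ^ 2 + a ^ 2) * (t ^ 2 + b ^ 2)) * ((t ^ 2 + a * b) / (4 * t ^ 2)) ^ 2 := by
      rw [hc]
      simp only [hf]
      field_simp
      ring
    have hpos : 0 < (t ^ 2 + a * b) / (4 * t ^ 2) := by positivity
    simp only [smul_eq_mul]
    rw [hP, Real.sqrt_mul (by positivity), Real.sqrt_sq hpos.le, abs_of_pos (by positivity)]
    have : 0 < √((t ^ 2 + a ^ 2) * (t ^ 2 + b ^ 2)) := Real.sqrt_pos.mpr (by positivity)
    field_simp
    ring
  rw [hrhs] at hmain
  exact mul_left_cancel₀ two_ne_zero hmain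

lemma agmIntegral_one_one : agmIntegral 1 1 = Real.pi / 2 := by
  have h := integral_Ioi_inv_one_add_sq (i := 0)
  rw [Real.arctan_zero, sub_zero] at h
  rw [agmIntegral, ← h]
  refine integral_congr_ae (Eventually.of_forall fun t => ?_)
  have : (t ^ 2 + 1 ^ 2) * (t ^ 2 + 1 ^ 2) = (1 + t ^ 2) ^ 2 := by ring
  simp only
  rw [this, Real.sqrt_sq (by positivity), one_div]

lemma tendsto_agmIntegral {a b : ℕ → ℝ} (ha : Tendsto a atTop (𝓝 1)) (hb : Tendsto b atTop (𝓝 1)) :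
    Tendsto (fun n => agmIntegral (a n) (b n)) atTop (𝓝 (Real.pi / 2)) := by
  rw [← agmIntegral_one_one]
  refine tendsto_integral_filter_of_dominated_convergence (fun t => 4 * (1 + t ^ 2)⁻¹) ?_ ?_ ?_ ?_
  · refine Eventually.of_forall fun n => ?_
    refine Measurable.aestronglyMeasurable ?_
    fun_prop
  · filter_upwards [ha.eventually (lt_mem_nhds (show (1 / 2 : ℝ) < 1 by norm_num)),
      hb.eventually (lt_mem_nhds (show (1 / 2 : ℝ) < 1 by norm_num))] with n h1 h2
    refine Eventually.of_forall fun t => ?_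
    have hle : ((1 + t ^ 2) / 4) ^ 2 ≤ (t ^ 2 + a n ^ 2) * (t ^ 2 + b n ^ 2) := by
      rw [sq]
      apply mul_le_mul <;> nlinarith [sq_nonneg t]
    have h3 : (1 + t ^ 2) / 4 ≤ √((t ^ 2 + a n ^ 2) * (t ^ 2 + b n ^ 2)) :=
      Real.le_sqrt_of_sq_le hle
    rw [Real.norm_of_nonneg (by positivity)]
    calc 1 / √((t ^ 2 + a n ^ 2) * (t ^ 2 + b n ^ 2)) ≤ 1 / ((1 + t ^ 2) / 4) :=
          one_div_le_one_div_of_le (by positivity) h3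
      _ = 4 * (1 + t ^ 2)⁻¹ := by field_simp
  · exact (integrable_inv_one_add_sq.const_mul 4).integrableOn
  · refine Eventually.of_forall fun t => ?_
    have hne : √((t ^ 2 + 1 ^ 2) * (t ^ 2 + 1 ^ 2)) ≠ 0 := (Real.sqrt_pos.mpr (by positivity)).ne'
    exact tendsto_const_nhds.div ((((ha.pow 2).const_add _).mul ((hb.pow 2).const_add _)).sqrt) hne

/-- The theta series with a real nome. -/
noncomputable def thetaR (r : ℝ) : ℝ := ∑' n : ℤ, r ^ (n.natAbs ^ 2)

lemma thetaQ_ofReal (r : ℝ) : thetaQ r = thetaR r := by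
  rw [thetaQ, thetaR, Complex.ofReal_tsum]
  simp

lemma thetaR_pos {r : ℝ} (h0 : 0 ≤ r) (h1 : r < 1) : 0 < thetaR r := by
  have hne : thetaR r ≠ 0 := by
    intro h
    apply thetaQ_ne_zero (q := r) (by simpa [abs_of_nonneg h0] using h1)
    rw [thetaQ_ofReal, h, Complex.ofReal_zero]
  exact lt_of_le_of_ne (tsum_nonneg fun n => pow_nonneg h0 _) hne.symm

lemma thetaR_sq_add {r : ℝ} (h : |r| < 1) :
    thetaR r ^ 2 + thetaR (-r) ^ 2 = 2 * thetaR (r ^ 2) ^ 2 := by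
  have := thetaQ_sq_add (q := r) (by simpa using h)
  rw [← Complex.ofReal_neg, ← Complex.ofReal_pow, thetaQ_ofReal, thetaQ_ofReal,
    thetaQ_ofReal] at this
  exact_mod_cast this

lemma thetaR_mul_neg {r : ℝ} (h : |r| < 1) : thetaR r * thetaR (-r) = thetaR (-r ^ 2) ^ 2 := by
  have := thetaQ_mul_neg (q := r) (by simpa using h)
  rw [← Complex.ofReal_pow, ← Complex.ofReal_neg, ← Complex.ofReal_neg, thetaQ_ofReal,
    thetaQ_ofReal, thetaQ_ofReal] at this
  exact_mod_cast this

lemma thetaR_neg_pos {r : ℝ} (h0 : 0 ≤ r) (h1 : r < 1) : 0 < thetaR (-r) := by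
  have hne : thetaR (-r) ≠ 0 := by
    intro h
    apply thetaQ_ne_zero (q := ((-r : ℝ) : ℂ)) (by simpa [abs_of_nonneg h0] using h1)
    rw [thetaQ_ofReal, h, Complex.ofReal_zero]
  have h2 := thetaR_mul_neg (r := r) (by rwa [abs_of_nonneg h0])
  have h3 := thetaR_pos h0 h1
  have h4 : 0 ≤ thetaR (-r) := by
    by_contra hneg
    have := mul_neg_of_pos_of_neg h3 (not_le.mp hneg)
    rw [h2] at this
    exact absurd this (not_lt.mpr (sq_nonneg _))
  exact lt_of_le_of_ne h4 hne.symm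

/-- By duplication, r ↦ r² is exactly one mean step on the pair (θ(r)², θ(-r)²), and the pair tends
to (1, 1). -/
theorem agmIntegral_thetaR {r : ℝ} (h0 : 0 ≤ r) (h1 : r < 1) :
    agmIntegral (thetaR r ^ 2) (thetaR (-r) ^ 2) = Real.pi / 2 := by
  have hr : ∀ n : ℕ, 0 ≤ r ^ 2 ^ n ∧ r ^ 2 ^ n < 1 :=
    fun n => ⟨pow_nonneg h0 _, pow_lt_one₀ h0 h1 (by positivity)⟩
  have hconst : ∀ n : ℕ, agmIntegral (thetaR (r ^ 2 ^ n) ^ 2) (thetaR (-r ^ 2 ^ n) ^ 2) =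
      agmIntegral (thetaR r ^ 2) (thetaR (-r) ^ 2) := by
    intro n
    induction n with
    | zero => simp
    | succ n ih =>
      obtain ⟨hn0, hn1⟩ := hr n
      have habs : |r ^ 2 ^ n| < 1 := by rwa [abs_of_nonneg hn0]
      rw [← ih, ← agmIntegral_step (pow_pos (thetaR_pos hn0 hn1) 2)
        (pow_pos (thetaR_neg_pos hn0 hn1) 2) (c := thetaR (-(r ^ 2 ^ n) ^ 2) ^ 2)
        (by rw [← thetaR_mul_neg habs]; ring), thetaR_sq_add habs, pow_succ 2, pow_mul]
      congr 1
      ring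
  have hQ0 : Tendsto thetaQ (𝓝 0) (𝓝 1) := by
    rw [← thetaQ_zero]
    exact (differentiableAt_thetaQ (by simp)).continuousAt
  have hlim : Tendsto (fun n : ℕ => r ^ 2 ^ n) atTop (𝓝 0) :=
    (tendsto_pow_atTop_nhds_zero_of_lt_one h0 h1).comp
      (tendsto_pow_atTop_atTop_of_one_lt one_lt_two)
  have hR : ∀ u : ℕ → ℝ, Tendsto u atTop (𝓝 0) →
      Tendsto (fun n => thetaR (u n) ^ 2) atTop (𝓝 1) := by
    intro u hu
    have hc : Tendsto (fun n => ((u n : ℝ) : ℂ)) atTop (𝓝 0) := by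
      exact_mod_cast (Complex.continuous_ofReal.tendsto 0).comp hu
    have h2 := (Complex.continuous_re.tendsto 1).comp (hQ0.comp hc)
    simp only [Function.comp_def, thetaQ_ofReal, Complex.ofReal_re, Complex.one_re] at h2
    simpa using h2.pow 2
  have hT := tendsto_agmIntegral (hR _ hlim) (hR (fun n => -r ^ 2 ^ n) (by simpa using hlim.neg))
  simp only [hconst] at hT
  exact tendsto_nhds_unique tendsto_const_nhds hT

end

/-! ### The lemniscatic Beta value and the constant Φ. -/

section

open Filter Topology MeasureTheory Set

/-- The substitution x = 1/(1 + t²)² carries the Beta integrand to the elliptic one. -/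
lemma betaIntegrand_lemniscate {t : ℝ} (ht : 0 < t) :
    4 * t / (1 + t ^ 2) ^ 3 * ((1 / (1 + t ^ 2) ^ 2) ^ (1 / 4 - 1 : ℝ) *
      (1 - 1 / (1 + t ^ 2) ^ 2) ^ (1 / 2 - 1 : ℝ)) =
    4 * (1 / √((t ^ 2 + √2 ^ 2) * (t ^ 2 + 1 ^ 2))) := by
  set w : ℝ := √(1 + t ^ 2) with hw
  have hx : (0 : ℝ) < 1 + t ^ 2 := by positivity
  have hw0 : 0 < w := Real.sqrt_pos.mpr hx
  have hw2 : 1 + t ^ 2 = w ^ 2 := (Real.sq_sqrt hx.le).symm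
  have h1 : (1 / (1 + t ^ 2) ^ 2 : ℝ) ^ (1 / 4 - 1 : ℝ) = w ^ 3 := by
    rw [hw2, one_div, ← pow_mul, Real.inv_rpow (by positivity), ← Real.rpow_natCast,
      ← Real.rpow_mul hw0.le, ← Real.rpow_neg hw0.le, ← Real.rpow_natCast]
    congr 1
    norm_num
  have h2 : (1 - 1 / (1 + t ^ 2) ^ 2 : ℝ) ^ (1 / 2 - 1 : ℝ) =
      (t * √(t ^ 2 + 2) / (1 + t ^ 2))⁻¹ := by
    have : (1 - 1 / (1 + t ^ 2) ^ 2 : ℝ) = (t * √(t ^ 2 + 2) / (1 + t ^ 2)) ^ 2 := by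
      rw [div_pow, mul_pow, Real.sq_sqrt (by positivity)]
      field_simp
      ring
    rw [this, ← Real.rpow_natCast, ← Real.rpow_mul (by positivity), ← Real.rpow_neg_one]
    congr 1
    norm_num
  have h3 : √((t ^ 2 + √2 ^ 2) * (t ^ 2 + 1 ^ 2)) = √(t ^ 2 + 2) * w := by
    rw [Real.sq_sqrt (by norm_num), Real.sqrt_mul (by positivity), hw, one_pow, add_comm 1]
  have h4 : 0 < √(t ^ 2 + 2) := Real.sqrt_pos.mpr (by positivity)
  rw [h1, h2, h3, hw2]
  field_simp

theorem four_mul_agmIntegral_sqrt_two :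
    4 * agmIntegral √2 1 = ProbabilityTheory.beta (1 / 4) (1 / 2) := by
  set f : ℝ → ℝ := fun t => 1 / (1 + t ^ 2) ^ 2 with hf
  have hderiv : ∀ t ∈ Ioi (0 : ℝ), HasDerivWithinAt f (-(4 * t / (1 + t ^ 2) ^ 3)) (Ioi 0) t := by
    intro t _
    have h1 : HasDerivAt (fun t : ℝ => ((1 + t ^ 2) ^ 2)⁻¹) _ t :=
      ((((hasDerivAt_pow 2 t).const_add 1).fun_pow 2).fun_inv (by positivity))
    have h2 : HasDerivAt f _ t := h1.congr_of_eventuallyEq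
      (Eventually.of_forall fun s => one_div _)
    refine (h2.congr_deriv ?_).hasDerivWithinAt
    push_cast
    field_simp
    ring
  have hinj : InjOn f (Ioi 0) := by
    intro s hs t ht hst
    have hs0 : 0 < s := hs
    have ht0 : 0 < t := ht
    simp only [hf, one_div] at hst
    have h1 := (pow_left_inj₀ (by positivity) (by positivity) two_ne_zero).mp (inv_injective hst)
    exact (pow_left_inj₀ hs0.le ht0.le two_ne_zero).mp (by linarith)
  have himage : f '' Ioi 0 = Ioo 0 1 := by
    ext v
    constructor
    · rintro ⟨t, ht, rfl⟩
      have ht0 : 0 < t := ht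
      refine ⟨by positivity, ?_⟩
      simp only [hf]
      rw [div_lt_one (by positivity)]
      nlinarith [pow_pos ht0 2]
    · rintro ⟨hv0, hv1⟩
      have hs0 : 0 < √v := Real.sqrt_pos.mpr hv0
      have hs1 : √v < 1 := by rw [Real.sqrt_lt' one_pos]; linarith
      have h1 : 0 < 1 / √v - 1 := by
        rw [sub_pos, lt_div_iff₀ hs0]; linarith
      refine ⟨√(1 / √v - 1), Real.sqrt_pos.mpr h1, ?_⟩
      simp only [hf]
      rw [Real.sq_sqrt h1.le, add_sub_cancel, div_pow, Real.sq_sqrt hv0.le]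
      simp
  rw [ProbabilityTheory.beta_eq_betaIntegralReal _ _ (by norm_num) (by norm_num),
    Complex.betaIntegral, intervalIntegral.integral_of_le zero_le_one,
    integral_Ioc_eq_integral_Ioo, ← himage,
    integral_image_eq_integral_abs_deriv_smul measurableSet_Ioi hderiv hinj]
  have hint : ∫ t in Ioi (0 : ℝ), |-(4 * t / (1 + t ^ 2) ^ 3)| •
      (((f t : ℝ) : ℂ) ^ (((1 / 4 : ℝ) : ℂ) - 1) *
        (1 - ((f t : ℝ) : ℂ)) ^ (((1 / 2 : ℝ) : ℂ) - 1)) =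
      ∫ t in Ioi (0 : ℝ), ((4 * (1 / √((t ^ 2 + √2 ^ 2) * (t ^ 2 + 1 ^ 2))) : ℝ) : ℂ) := by
    refine setIntegral_congr_fun measurableSet_Ioi fun t ht => ?_
    have ht0 : 0 < t := ht
    have hf0 : 0 ≤ f t := by positivity
    have hf1 : 0 ≤ 1 - f t := by
      have : f t ∈ Ioo (0 : ℝ) 1 := himage ▸ mem_image_of_mem f ht
      linarith [this.2]
    rw [← betaIntegrand_lemniscate ht0, abs_neg, abs_of_pos (by positivity),
      Complex.real_smul, Complex.ofReal_mul, Complex.ofReal_mul, ← Complex.ofReal_one,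
      ← Complex.ofReal_sub, ← Complex.ofReal_sub, ← Complex.ofReal_sub, Complex.ofReal_cpow hf0,
      Complex.ofReal_cpow hf1]
  rw [hint, integral_complex_ofReal, Complex.ofReal_re, integral_const_mul, agmIntegral]

lemma agmIntegral_mul {c : ℝ} (hc : 0 < c) (a b : ℝ) :
    agmIntegral (c * a) (c * b) = agmIntegral a b / c := by
  have h := integral_comp_mul_left_Ioi
    (fun t => 1 / √((t ^ 2 + (c * a) ^ 2) * (t ^ 2 + (c * b) ^ 2))) 0 hc
  rw [mul_zero, smul_eq_mul] at h
  have h2 : ∫ t in Ioi (0 : ℝ), 1 / √(((c * t) ^ 2 + (c * a) ^ 2) * ((c * t) ^ 2 + (c * b) ^ 2)) =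
      (c ^ 2)⁻¹ * agmIntegral a b := by
    rw [agmIntegral, ← integral_const_mul]
    refine integral_congr_ae (Eventually.of_forall fun t => ?_)
    have : ((c * t) ^ 2 + (c * a) ^ 2) * ((c * t) ^ 2 + (c * b) ^ 2) =
        (c ^ 2) ^ 2 * ((t ^ 2 + a ^ 2) * (t ^ 2 + b ^ 2)) := by ring
    simp only
    rw [this, Real.sqrt_mul (by positivity), Real.sqrt_sq (by positivity), one_div, mul_inv,
      one_div]
  rw [h2] at h
  rw [agmIntegral]
  field_simp at h ⊢
  linear_combination -h

/-- The reflection formula at 1/4 eliminates Γ(3/4). -/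
lemma beta_quarter_half : ProbabilityTheory.beta (1 / 4) (1 / 2) ^ 4 * (4 * Real.pi ^ 2) =
    Real.Gamma (1 / 4) ^ 8 := by
  have h1 := Real.Gamma_mul_Gamma_one_sub (1 / 4)
  rw [show Real.pi * (1 / 4) = Real.pi / 4 by ring, Real.sin_pi_div_four] at h1
  have h2 := Real.Gamma_one_half_eq
  have h3 : 0 < Real.Gamma (3 / 4) := Real.Gamma_pos_of_pos (by norm_num)
  rw [show (1 : ℝ) - 1 / 4 = 3 / 4 by norm_num] at h1
  rw [ProbabilityTheory.beta, show (1 / 4 + 1 / 2 : ℝ) = 3 / 4 by norm_num, h2, div_pow, mul_pow]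
  have hs : √Real.pi ^ 4 = Real.pi ^ 2 := by
    rw [show 4 = 2 * 2 by norm_num, pow_mul, Real.sq_sqrt Real.pi_pos.le]
  have h4 : (Real.Gamma (1 / 4) * Real.Gamma (3 / 4)) ^ 4 = 4 * Real.pi ^ 4 := by
    rw [h1, div_pow, div_pow, show (√2 : ℝ) ^ 4 = 4 by
      rw [show 4 = 2 * 2 by norm_num, pow_mul, Real.sq_sqrt (by norm_num)]; norm_num]
    field_simp
    norm_num
  rw [hs, div_mul_eq_mul_div, div_eq_iff (by positivity)]
  linear_combination -(Real.Gamma (1 / 4)) ^ 4 * h4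

/-- At r = e^(-π) the pair (θ(r)², θ(-r)²) is proportional to (√2, 1), so homogeneity of the
integral gives B(1/4, 1/2) = 2πθ(-r)². -/
theorem romikPhi_eq : (romikPhi : ℂ) = diskKappa ^ 2 * theta3 1 ^ 8 := by
  have hexp : Complex.exp (-(Real.pi : ℂ)) = ((Real.exp (-Real.pi) : ℝ) : ℂ) := by push_cast; rfl
  set r := Real.exp (-Real.pi) with hr
  have hr0 : 0 ≤ r := (Real.exp_pos _).le
  have hr1 : r < 1 := by rw [hr, Real.exp_lt_one_iff]; linarith [Real.pi_pos]
  have hpow := thetaQ_exp_neg_pi_pow_four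
  rw [hexp, ← Complex.ofReal_neg, thetaQ_ofReal, thetaQ_ofReal] at hpow
  have hpow' : thetaR r ^ 4 = 2 * thetaR (-r) ^ 4 := by exact_mod_cast hpow
  have ha := thetaR_pos hr0 hr1
  have hb := thetaR_neg_pos hr0 hr1
  have hab : thetaR r ^ 2 = thetaR (-r) ^ 2 * √2 := by
    rw [← Real.sqrt_sq (by positivity : 0 ≤ thetaR (-r) ^ 2), ← Real.sqrt_mul (by positivity),
      ← Real.sqrt_sq (by positivity : 0 ≤ thetaR r ^ 2)]
    congr 1
    linear_combination hpow'
  have hK := agmIntegral_thetaR hr0 hr1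
  have hb2 : thetaR (-r) ^ 2 = thetaR (-r) ^ 2 * 1 := (mul_one _).symm
  rw [hab] at hK
  nth_rewrite 2 [hb2] at hK
  rw [agmIntegral_mul (by positivity), div_eq_iff (by positivity)] at hK
  have hbeta : ProbabilityTheory.beta (1 / 4) (1 / 2) = 2 * Real.pi * thetaR (-r) ^ 2 := by
    rw [← four_mul_agmIntegral_sqrt_two, hK]; ring
  have hG := beta_quarter_half
  rw [hbeta] at hG
  have hreal : romikPhi = Real.pi ^ 2 / 8 * thetaR r ^ 8 := by
    have h8 : thetaR r ^ 8 = 4 * thetaR (-r) ^ 8 := by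
      linear_combination (thetaR r ^ 4 + 2 * thetaR (-r) ^ 4) * hpow'
    have hpi := Real.pi_ne_zero
    rw [romikPhi, ← hG, h8]
    field_simp
    ring
  rw [hreal, theta3_one, hexp, thetaQ_ofReal, diskKappa_sq]
  push_cast
  rfl

theorem romikInt_eq_romikD (n : ℕ) : (romikInt n : ℂ) = romikD n := by
  have hA : theta3 1 ≠ 0 := by
    rw [theta3_one]; exact thetaQ_ne_zero norm_exp_neg_pi
  have hk := diskKappa_ne_zero
  rw [romikD, iteratedDeriv_romikSigma_zero, romikPhi_eq, eq_div_iff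
    (mul_ne_zero hA (pow_ne_zero _ (mul_ne_zero (pow_ne_zero _ hk) (pow_ne_zero _ hA))))]
  ring

end

/-! ### Assembly of the theorem. -/

theorem theorem1 :
    ∃ d : ℕ → ℤ, (∀ n : ℕ, (d n : ℂ) = romikD n) ∧
      (∀ n : ℕ, d n ≡ 1 [ZMOD 2]) ∧
      (∀ n : ℕ, 1 ≤ n → d n ≡ (-1) ^ (n + 1) [ZMOD 5]) ∧
      (∀ p : ℕ, p.Prime → p ≡ 3 [MOD 4] →
        ∀ n : ℕ, ((p : ℚ) ^ 2 - 1) / 2 < (n : ℚ) → d n ≡ 0 [ZMOD (p : ℤ)]) := by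
  refine ⟨romikInt, romikInt_eq_romikD, romikInt_modEq_two, fun n hn => romikInt_modEq_five hn,
    fun p hp h3 n hn => romikInt_modEq_prime hp h3 ?_⟩
  -- The strict rational bound amounts to p² ≤ 2n over the integers, the exact range of the
  -- vanishing result.
  have h : (p : ℚ) ^ 2 < 2 * n + 1 := by linarith
  have h' : p ^ 2 < 2 * n + 1 := by exact_mod_cast h
  omega
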